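/- For a set $X$ let $[X]^{<\omega}$ denote the set of all finite subsets of $X$. A set is called \emph{Dedekind-infinite} if there is an injection of $\omega$ into it. Consider the following statements of set theory. - $\mathsf{HT}$ (Hindman's theorem): for every infinite set $X$ and every colouring $c:[X]^{<\omega}\to 2$ there is an infinite, pairwise disjoint family $Y\subseteq[X]^{<\omega}$ such that $c$ is constant on the set $$\mathrm{FU}(Y)=\Big\{\textstyle\bigcup_{y\in F}y \;:\; F\in[Y]^{<\omega}\setminus\{\varnothing\}\Big\}.$$ - $\mathrm{Fin}=\mathrm{D}\text{-}\mathrm{Fin}$: every infinite set is Dedekind-infinite. - Form 82: for every infinite set $X$, the powerset $\wp(X)$ is Dedekind-infinite. Then, in $\mathsf{ZF}$ (Zermelo–Fraenkel set theory without the axiom of choice), that is, in every model of $\mathsf{ZF}$, the statement $\mathsf{HT}$ is equivalent to the statement that for every infinite set $X$ the set $[X]^{<\omega}$ is Dedekind-infinite. Moreover, in $\mathsf{ZF}$, $\mathrm{Fin}=\mathrm{D}\text{-}\mathrm{Fin}$ implies $\mathsf{HT}$, and $\mathsf{HT}$ implies Form 82. -/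

import Mathlib

open FirstOrder

namespace ZFModel

/-- The only non-logical symbol of the language of set theory: a binary relation symbol. -/
inductive SetRel : ℕ → Type
  | mem : SetRel 2

/-- The first-order language of set theory. -/
def setLang : Language := ⟨fun _ => Empty, SetRel⟩

/-- `Mem x y`: the structure `M` believes that `x` is an element of `y`. -/
def Mem {M : Type*} [setLang.Structure M] (x y : M) : Prop :=
  Language.Structure.RelMap (L := setLang) SetRel.mem ![x, y]

infix:50 " ∈ₘ " => ZFModel.Mem

section Vocabulary

/-! All quantifiers below range over the elements of the structure `M`, so that each of these
predicates is the interpretation in `M` of a formula of the language of set theory. -/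

variable {M : Type*} [setLang.Structure M]

/-- `x ⊆ y`. -/
def Subset (x y : M) : Prop := ∀ z, z ∈ₘ x → z ∈ₘ y

/-- `x = ∅`. -/
def IsEmptySet (x : M) : Prop := ∀ z, ¬ z ∈ₘ x

/-- `p = {a, b}`. -/
def IsUPair (p a b : M) : Prop := ∀ z, z ∈ₘ p ↔ z = a ∨ z = b

/-- `p = (a, b) = {{a}, {a, b}}`. -/
def IsOPair (p a b : M) : Prop := ∃ s t, IsUPair s a a ∧ IsUPair t a b ∧ IsUPair p s t

/-- `u = ⋃ F`. -/
def IsUnion (u F : M) : Prop := ∀ z, z ∈ₘ u ↔ ∃ y, y ∈ₘ F ∧ z ∈ₘ y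

/-- `P = ℘(x)`. -/
def IsPowerset (P x : M) : Prop := ∀ z, z ∈ₘ P ↔ Subset z x

/-- `s = x ∪ {x}`. -/
def IsSucc (s x : M) : Prop := ∀ z, z ∈ₘ s ↔ z ∈ₘ x ∨ z = x

/-- `w` contains `∅` and is closed under `x ↦ x ∪ {x}`. -/
def IsInductive (w : M) : Prop :=
  (∃ z, IsEmptySet z ∧ z ∈ₘ w) ∧ ∀ x, x ∈ₘ w → ∃ s, IsSucc s x ∧ s ∈ₘ w

/-- `w = ω`, the least inductive set. -/
def IsOmega (w : M) : Prop := IsInductive w ∧ ∀ v, IsInductive v → Subset w v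

/-- `t = 2 = {0, 1}`, as a von Neumann natural number. -/
def IsTwo (t : M) : Prop := ∃ z o, IsEmptySet z ∧ IsSucc o z ∧ IsSucc t o

/-- `(x, y) ∈ f`; for a function `f` this says `f(x) = y`. -/
def App (f x y : M) : Prop := ∃ p, IsOPair p x y ∧ p ∈ₘ f

/-- `f : a → b` is a function. -/
def IsFun (f a b : M) : Prop :=
  (∀ p, p ∈ₘ f → ∃ x y, x ∈ₘ a ∧ y ∈ₘ b ∧ IsOPair p x y) ∧
    ∀ x, x ∈ₘ a → ∃! y, App f x y

/-- `f : a → b` is an injective function. -/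
def IsInj (f a b : M) : Prop :=
  IsFun f a b ∧ ∀ x x' y, App f x y → App f x' y → x = x'

/-- `f : a → b` is a bijective function. -/
def IsBij (f a b : M) : Prop :=
  IsInj f a b ∧ ∀ y, y ∈ₘ b → ∃ x, x ∈ₘ a ∧ App f x y

/-- `x` is finite: some `n ∈ ω` is in bijection with `x`. -/
def IsFinite (x : M) : Prop := ∃ w n f, IsOmega w ∧ n ∈ₘ w ∧ IsBij f n x

/-- `x` is Dedekind-infinite: `ω` injects into `x`. -/
def IsDedekindInfinite (x : M) : Prop := ∃ w f, IsOmega w ∧ IsInj f w x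

/-- `P = [x]^{<ω}`, the set of finite subsets of `x`. -/
def IsFinPowerset (P x : M) : Prop := ∀ z, z ∈ₘ P ↔ Subset z x ∧ IsFinite z

/-- The elements of `Y` are pairwise disjoint. -/
def IsPairwiseDisjoint (Y : M) : Prop :=
  ∀ a b, a ∈ₘ Y → b ∈ₘ Y → a ≠ b → ¬ ∃ z, z ∈ₘ a ∧ z ∈ₘ b

/-- `U = FU(Y)`, the set of all unions of nonempty finite subsets of `Y`. -/
def IsFU (U Y : M) : Prop :=
  ∀ u, u ∈ₘ U ↔ ∃ F, Subset F Y ∧ IsFinite F ∧ ¬ IsEmptySet F ∧ IsUnion u F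

/-- `c` takes one and the same value on all elements of `U`. -/
def IsMonochromatic (c U : M) : Prop := ∃ i, ∀ u, u ∈ₘ U → App c u i

end Vocabulary

/-- `M` is a model of Zermelo–Fraenkel set theory without the axiom of choice. In the two schemata
`φ` ranges over the formulas of the language of set theory and `p` is a tuple of parameters. -/
structure IsModelZF (M : Type*) [setLang.Structure M] : Prop where
  extensionality : ∀ x y : M, (∀ z, z ∈ₘ x ↔ z ∈ₘ y) → x = y
  foundation : ∀ x : M, ¬ IsEmptySet x → ∃ y, y ∈ₘ x ∧ ¬ ∃ z, z ∈ₘ y ∧ z ∈ₘ x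
  pairing : ∀ a b : M, ∃ p, IsUPair p a b
  union : ∀ F : M, ∃ u, IsUnion u F
  powerset : ∀ x : M, ∃ P, IsPowerset P x
  infinity : ∃ w : M, IsInductive w
  separation : ∀ (n : ℕ) (φ : setLang.Formula (Fin (n + 1))) (p : Fin n → M) (a : M),
    ∃ b : M, ∀ x, x ∈ₘ b ↔ x ∈ₘ a ∧ φ.Realize (Fin.cons x p : Fin (n + 1) → M)
  replacement : ∀ (n : ℕ) (φ : setLang.Formula (Fin (n + 2))) (p : Fin n → M) (a : M),
    (∀ x y y', x ∈ₘ a →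
      φ.Realize (Fin.cons x (Fin.cons y p : Fin (n + 1) → M) : Fin (n + 2) → M) →
      φ.Realize (Fin.cons x (Fin.cons y' p : Fin (n + 1) → M) : Fin (n + 2) → M) → y = y') →
    ∃ b : M, ∀ y, y ∈ₘ b ↔ ∃ x, x ∈ₘ a ∧
      φ.Realize (Fin.cons x (Fin.cons y p : Fin (n + 1) → M) : Fin (n + 2) → M)

section Principles

variable (M : Type*) [setLang.Structure M]

/-- `M` satisfies Hindman's theorem: for every infinite set `X` and every colouring
`c : [X]^{<ω} → 2` there is an infinite, pairwise disjoint `Y ⊆ [X]^{<ω}` such that `FU(Y)` is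
`c`-monochromatic. -/
def HT : Prop :=
  ∀ X : M, ¬ IsFinite X → ∀ P t c : M, IsFinPowerset P X → IsTwo t → IsFun c P t →
    ∃ Y : M, Subset Y P ∧ ¬ IsFinite Y ∧ IsPairwiseDisjoint Y ∧
      ∃ U : M, IsFU U Y ∧ IsMonochromatic c U

/-- `M` satisfies: for every infinite set `X`, the set `[X]^{<ω}` is Dedekind-infinite. -/
def FinPowersetsDedekindInfinite : Prop :=
  ∀ X : M, ¬ IsFinite X → ∃ P : M, IsFinPowerset P X ∧ IsDedekindInfinite P

/-- `M` satisfies `Fin = D-Fin`: every infinite set is Dedekind-infinite. -/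
def FinEqDFin : Prop := ∀ X : M, ¬ IsFinite X → IsDedekindInfinite X

/-- `M` satisfies Form 82: for every infinite set `X`, its powerset is Dedekind-infinite. -/
def Form82 : Prop := ∀ X : M, ¬ IsFinite X → ∃ P : M, IsPowerset P X ∧ IsDedekindInfinite P

end Principles

end ZFModel

/-! From `HT` to Dedekind-infinity: colour a finite set by whether its cardinality lies in `altSet`,
a set containing exactly one of `k` and `2k` for every `k ≠ 0`. If two distinct, hence disjoint,
members `y`, `y'` of the family given by `HT` had the same cardinality `k`, then `k ≠ 0`, and `y`
and `y ∪ y'` would get different colours. So cardinality is injective on an infinite family, and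
listing the family by increasing cardinality embeds `ω` into `[X]^{<ω}`.

Conversely, let `f : ω → [X]^{<ω}` be injective. Sort the points of `⋃ f(n)` by the least `n` with
`x ∈ f(n)`. The indices that occur are unbounded, and a finite set `t` of them yields the nonempty
finite block `blk X f t` of points that appear first at an index in `t`. Disjoint index sets give
disjoint blocks and unions go to unions, so the problem reduces to Hindman's theorem for finite
subsets of `ω`. This is provable in ZF by a Baumgartner-style argument on largeness
(`Large.exists_finite_cover`, `Large.exists_shift`, `Large.exists_mem_shift`,
`Large.exists_isIP_subset`): its dependent choices become definable recursions, because `ch` picks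
definably from nonempty sets of finite subsets of `ω`.

The other implications are easy: `[X]^{<ω}` contains all singletons, so it is infinite when `X` is,
and it is a subset of `℘(X)`.

Everything takes place inside an arbitrary model, whose `ω` may be nonstandard. Separation,
replacement and induction are thus available only for predicates definable with parameters; `DfnP`
and `DfnF` let instance search supply the definability. -/

namespace ZFModel

universe u

/-! ### First-order definability with parameters -/

/-- `E` is a finite power of `M`, up to currying. -/
class Ctx (M : Type u) (E : Type u) where
  /-- the index set of the coordinates -/
  idx : Type
  /-- the coordinates of an element of `E` -/
  dec : (idx → M) ≃ E

instance Ctx.base (M : Type u) : Ctx M M := ⟨Unit, Equiv.funUnique Unit M⟩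

instance Ctx.snoc (M E : Type u) [Ctx M E] : Ctx M (E × M) :=
  ⟨Ctx.idx M E ⊕ Unit,
    (Equiv.sumArrowEquivProdArrow (Ctx.idx M E) Unit M).trans
      (Equiv.prodCongr Ctx.dec (Equiv.funUnique Unit M))⟩

/-- `P` is definable with parameters in the language of set theory. -/
class DfnP (M : Type u) [setLang.Structure M] {E : Type u} [Ctx M E] (P : E → Prop) : Prop where
  out : ∃ (n : ℕ) (p : Fin n → M) (φ : setLang.Formula (Fin n ⊕ Ctx.idx M E)),
    ∀ v, φ.Realize (Sum.elim p v) ↔ P (Ctx.dec v)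

/-- The graph of `f` is definable with parameters. -/
class DfnF {M : Type u} [setLang.Structure M] {E : Type u} [Ctx M E] (f : E → M) : Prop where
  out : DfnP M fun p : E × M => p.2 = f p.1

/-- `f` selects coordinates. -/
class Coord (M : Type u) {E F : Type u} [Ctx M E] [Ctx M F] (f : E → F) : Prop where
  out : ∃ g : Ctx.idx M F → Ctx.idx M E, ∀ v : Ctx.idx M E → M, f (Ctx.dec v) = Ctx.dec (v ∘ g)

/-! ### Closure of definability under connectives, quantifiers, substitution and description -/

section Closure

set_option linter.unusedSectionVars false

variable {M : Type u} [setLang.Structure M] {E F : Type u} [Ctx M E] [Ctx M F]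

instance Coord.refl : Coord M (fun e : E => e) := ⟨id, fun _ => rfl⟩

instance Coord.fst (f : E → F × M) [h : Coord M f] : Coord M (fun e => (f e).1) := by
  obtain ⟨g, hg⟩ := h.out
  exact ⟨fun i => g (Sum.inl i), fun v => by rw [hg]; rfl⟩

instance Coord.snd (f : E → F × M) [h : Coord M f] : Coord M (fun e => (f e).2) := by
  obtain ⟨g, hg⟩ := h.out
  exact ⟨fun i => g (Sum.inr i), fun v => by rw [hg]; rfl⟩

theorem Coord.pair (f : E → F) (t : E → M) [hf : Coord M f] [ht : Coord M t] :
    Coord M (fun e => (f e, t e)) := by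
  obtain ⟨g, hg⟩ := hf.out
  obtain ⟨k, hk⟩ := ht.out
  exact ⟨Sum.elim g k, fun v => by rw [hg, hk]; rfl⟩

theorem DfnP.comp_coord (P : F → Prop) (f : E → F) [hP : DfnP M P] [hf : Coord M f] :
    DfnP M (fun e => P (f e)) := by
  obtain ⟨n, p, φ, hφ⟩ := hP.out
  obtain ⟨g, hg⟩ := hf.out
  refine ⟨n, p, φ.relabel (Sum.map id g), fun v => ?_⟩
  rw [Language.Formula.realize_relabel, hg, ← hφ, Sum.elim_comp_map]
  rfl

theorem DfnP.of_iff (P : E → Prop) {Q : E → Prop} [hP : DfnP M P] (h : ∀ e, Q e ↔ P e) :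
    DfnP M Q := by
  rwa [show Q = P from funext fun e => propext (h e)]

instance DfnP.const (p : Prop) : DfnP M (fun _ : E => p) := by
  by_cases h : p
  · exact ⟨0, Fin.elim0, ⊤, fun v => by simp [h]⟩
  · exact ⟨0, Fin.elim0, ⊥, fun v => by simp [h]⟩

instance DfnP.imp (P Q : E → Prop) [hP : DfnP M P] [hQ : DfnP M Q] :
    DfnP M (fun e => P e → Q e) := by
  obtain ⟨n, p, φ, hφ⟩ := hP.out
  obtain ⟨m, q, ψ, hψ⟩ := hQ.out
  -- The two parameter tuples are concatenated, and each formula is relabelled to its own half.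
  refine ⟨n + m, Fin.append p q, (φ.relabel (Sum.map (Fin.castAdd m) id)).imp
    (ψ.relabel (Sum.map (Fin.natAdd n) id)), fun v => ?_⟩
  rw [Language.Formula.realize_imp, Language.Formula.realize_relabel,
    Language.Formula.realize_relabel, ← hφ, ← hψ, Sum.elim_comp_map, Sum.elim_comp_map]
  simp [Function.comp_def]

instance DfnP.not (P : E → Prop) [DfnP M P] : DfnP M (fun e => ¬ P e) :=
  DfnP.imp P fun _ => False

instance DfnP.or (P Q : E → Prop) [DfnP M P] [DfnP M Q] : DfnP M (fun e => P e ∨ Q e) :=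
  DfnP.of_iff (fun e => ¬ P e → Q e) fun _ => or_iff_not_imp_left

instance DfnP.and (P Q : E → Prop) [DfnP M P] [DfnP M Q] : DfnP M (fun e => P e ∧ Q e) :=
  DfnP.of_iff (fun e => ¬ (P e → ¬ Q e)) fun _ => by tauto

instance DfnP.iff (P Q : E → Prop) [DfnP M P] [DfnP M Q] : DfnP M (fun e => P e ↔ Q e) :=
  DfnP.of_iff (fun e => (P e → Q e) ∧ (Q e → P e)) fun _ => iff_def

instance DfnP.exists (P : E → M → Prop) [hP : DfnP M fun p : E × M => P p.1 p.2] :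
    DfnP M (fun e => ∃ x, P e x) := by
  obtain ⟨n, p, φ, hφ⟩ := hP.out
  refine ⟨n, p, Language.Formula.iExs (α := Fin n ⊕ Ctx.idx M E) Unit
    (φ.relabel (Equiv.sumAssoc (Fin n) (Ctx.idx M E) Unit).symm), fun v => ?_⟩
  rw [Language.Formula.realize_iExs]
  have key : ∀ i : Unit → M, (φ.relabel (Equiv.sumAssoc (Fin n) (Ctx.idx M E) Unit).symm).Realize
      (Sum.elim (Sum.elim p v) i) ↔ P (Ctx.dec v) (i ()) := fun i => by
    rw [Language.Formula.realize_relabel]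
    have : Sum.elim (Sum.elim p v) i ∘ (Equiv.sumAssoc (Fin n) (Ctx.idx M E) Unit).symm =
        Sum.elim p (Sum.elim v i) := by
      ext x; rcases x with x | x | x <;> rfl
    rw [this]
    exact hφ (Sum.elim v i)
  constructor
  · rintro ⟨i, hi⟩; exact ⟨_, (key i).1 hi⟩
  · rintro ⟨x, hx⟩; exact ⟨fun _ => x, (key _).2 hx⟩

instance DfnP.forall (P : E → M → Prop) [DfnP M fun p : E × M => P p.1 p.2] :
    DfnP M (fun e => ∀ x, P e x) :=
  DfnP.of_iff (fun e => ¬ ∃ x, ¬ P e x) fun _ => by push Not; rfl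

theorem DfnP.mem_coord : DfnP M (fun p : M × M => p.1 ∈ₘ p.2) := by
  refine ⟨0, Fin.elim0, (show setLang.Relations 2 from SetRel.mem).formula₂
    (Language.Term.var (Sum.inr (Sum.inl ()))) (Language.Term.var (Sum.inr (Sum.inr ()))),
    fun v => ?_⟩
  rw [Language.Formula.realize_rel₂]
  rfl

theorem DfnP.eq_coord : DfnP M (fun p : M × M => p.1 = p.2) := by
  refine ⟨0, Fin.elim0, Language.Term.equal
    (Language.Term.var (Sum.inr (Sum.inl ()))) (Language.Term.var (Sum.inr (Sum.inr ()))),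
    fun v => ?_⟩
  rw [Language.Formula.realize_equal]
  rfl

instance (priority := high) DfnF.coord (f : E → M) [Coord M f] : DfnF f := by
  have := DfnP.eq_coord (M := M)
  have := Coord.pair (M := M) (fun p : E × M => p.2) (fun p : E × M => f p.1)
    (ht := by
      obtain ⟨g, hg⟩ := Coord.out (M := M) (f := f)
      exact ⟨fun i => Sum.inl (g i), fun v => by
        exact hg fun i => v (Sum.inl i)⟩)
  exact ⟨DfnP.comp_coord (fun p : M × M => p.1 = p.2) (fun p : E × M => (p.2, f p.1))⟩

instance DfnF.const (c : M) : DfnF (fun _ : E => c) := by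
  refine ⟨1, fun _ => c, Language.Term.equal
    (Language.Term.var (Sum.inr (Sum.inr ()))) (Language.Term.var (Sum.inl 0)), fun v => ?_⟩
  rw [Language.Formula.realize_equal]
  rfl

/-- The language has no function symbols, so a definable term is substituted through its graph: some
`x` equals `f e` and satisfies `P e`. -/
theorem DfnP.comp_snoc (P : E → M → Prop) (f : E → M) [hP : DfnP M fun p : E × M => P p.1 p.2]
    [hf : DfnF f] : DfnP M (fun e => P e (f e)) := by
  have := hf.out
  exact DfnP.of_iff (fun e => ∃ x, x = f e ∧ P e x) (by simp)

/-- `R` is a definable property. -/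
class Def1 (R : M → Prop) : Prop where
  out : DfnP M fun p : M => R p

/-- `R` is a definable binary relation. -/
class Def2 (R : M → M → Prop) : Prop where
  out : DfnP M fun p : M × M => R p.1 p.2

/-- `R` is a definable ternary relation. -/
class Def3 (R : M → M → M → Prop) : Prop where
  out : DfnP M fun p : (M × M) × M => R p.1.1 p.1.2 p.2

/-- `f` is a definable function. -/
class Fn1 (f : M → M) : Prop where
  out : DfnF fun p : M => f p

/-- `f` is a definable binary function. -/
class Fn2 (f : M → M → M) : Prop where
  out : DfnF fun p : M × M => f p.1 p.2

theorem Coord.prodMap (f : E → F) [hf : Coord M f] :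
    Coord M (fun p : E × M => (f p.1, p.2)) := by
  obtain ⟨g, hg⟩ := hf.out
  exact ⟨Sum.map g id, fun v => Prod.ext (hg fun i => v (Sum.inl i)) rfl⟩

theorem DfnF.comp_coord (h : F → M) (f : E → F) [hh : DfnF h] [Coord M f] :
    DfnF (fun e => h (f e)) := by
  have := hh.out
  have := Coord.prodMap (M := M) f
  exact ⟨DfnP.comp_coord (fun p : F × M => p.2 = h p.1) (fun p : E × M => (f p.1, p.2))⟩

instance (priority := low) Def1.dfnP (R : M → Prop) [h : Def1 R] : DfnP M R := h.out

instance (priority := low) Fn1.dfnF (f : M → M) [h : Fn1 f] : DfnF f := h.out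

instance DfnP.comp1 (R : M → Prop) (f : E → M) [hR : Def1 R] [DfnF f] :
    DfnP M (fun e => R (f e)) := by
  have := hR.out
  have := DfnP.comp_coord (M := M) R (fun p : E × M => p.2)
  exact DfnP.comp_snoc (fun _ x => R x) f

instance DfnP.comp2 (R : M → M → Prop) (f g : E → M) [hR : Def2 R] [DfnF f] [DfnF g] :
    DfnP M (fun e => R (f e) (g e)) := by
  have := hR.out
  have := Coord.pair (M := M) (fun p : (E × M) × M => p.1.2) (fun p : (E × M) × M => p.2)
  have := DfnP.comp_coord (M := M) (fun p : M × M => R p.1 p.2) (fun p : (E × M) × M => (p.1.2, p.2))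
  have := DfnF.comp_coord g (fun p : E × M => p.1)
  have := DfnP.comp_snoc (M := M) (fun p : E × M => R p.2) (fun p => g p.1)
  exact DfnP.comp_snoc (fun e x => R x (g e)) f

instance DfnP.comp3 (R : M → M → M → Prop) (f g h : E → M) [hR : Def3 R] [DfnF f] [DfnF g]
    [DfnF h] : DfnP M (fun e => R (f e) (g e) (h e)) := by
  have := hR.out
  have := Coord.pair (M := M) (fun p : ((E × M) × M) × M => p.1.1.2)
    (fun p : ((E × M) × M) × M => p.1.2)
  have := Coord.pair (M := M) (fun p : ((E × M) × M) × M => (p.1.1.2, p.1.2))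
    (fun p : ((E × M) × M) × M => p.2)
  have := DfnP.comp_coord (M := M) (fun p : (M × M) × M => R p.1.1 p.1.2 p.2)
    (fun p : ((E × M) × M) × M => ((p.1.1.2, p.1.2), p.2))
  have := DfnF.comp_coord h (fun p : (E × M) × M => p.1.1)
  have := DfnP.comp_snoc (M := M) (fun p : (E × M) × M => R p.1.2 p.2) (fun p => h p.1.1)
  have := DfnF.comp_coord g (fun p : E × M => p.1)
  have := DfnP.comp_snoc (M := M) (fun (p : E × M) x => R p.2 x (h p.1)) (fun p => g p.1)
  exact DfnP.comp_snoc (fun e x => R x (g e) (h e)) f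

instance : Def2 (M := M) Mem := ⟨DfnP.mem_coord⟩

instance DfnP.eq (f g : E → M) [DfnF f] [DfnF g] : DfnP M (fun e => f e = g e) :=
  have : Def2 (M := M) Eq := ⟨DfnP.eq_coord⟩
  DfnP.comp2 Eq f g

instance DfnP.existsUnique (P : E → M → Prop) [hP : DfnP M fun p : E × M => P p.1 p.2] :
    DfnP M (fun e => ∃! x, P e x) := by
  have := Coord.pair (M := M) (fun p : (E × M) × M => p.1.1) (fun p : (E × M) × M => p.2)
  have := DfnP.comp_coord (M := M) (fun p : E × M => P p.1 p.2) (fun p : (E × M) × M => (p.1.1, p.2))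
  unfold ExistsUnique
  infer_instance

instance DfnF.comp1 (F : M → M) (f : E → M) [hF : Fn1 F] [DfnF f] :
    DfnF (fun e => F (f e)) := by
  have := hF.out.out
  have : Def2 fun x y => y = F x := ⟨this⟩
  have := DfnF.comp_coord f (fun p : E × M => p.1)
  exact ⟨DfnP.comp2 (fun x y => y = F x) (fun p : E × M => f p.1) (fun p => p.2)⟩

instance DfnF.comp2 (F : M → M → M) (f g : E → M) [hF : Fn2 F] [DfnF f] [DfnF g] :
    DfnF (fun e => F (f e) (g e)) := by
  have := hF.out.out
  have : Def3 fun x y z => z = F x y := ⟨this⟩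
  have := DfnF.comp_coord f (fun p : E × M => p.1)
  have := DfnF.comp_coord g (fun p : E × M => p.1)
  exact ⟨DfnP.comp3 (fun x y z => z = F x y) (fun p : E × M => f p.1) (fun p => g p.1)
    (fun p => p.2)⟩

instance Def2.def1 (R : M → M → Prop) (a : M) [Def2 R] : Def1 (R a) :=
  ⟨DfnP.comp2 R (fun _ => a) fun x => x⟩

instance Fn2.fn1 (F : M → M → M) (a : M) [Fn2 F] : Fn1 (F a) :=
  ⟨DfnF.comp2 F (fun _ => a) fun x => x⟩

/-- The unique `x` with `P x`, and an arbitrary element if there is none. -/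
noncomputable def theM [Nonempty M] (P : M → Prop) : M := by
  classical exact if h : ∃! x, P x then h.choose else Classical.arbitrary M

theorem theM_eq [Nonempty M] {P : M → Prop} {x : M} (hx : P x) (h : ∀ y, P y → y = x) :
    theM P = x := by
  have : ∃! x, P x := ⟨x, hx, h⟩
  rw [theM, dif_pos this]
  exact h _ this.choose_spec.1

theorem theM_spec [Nonempty M] {P : M → Prop} (h : ∃! x, P x) : P (theM P) := by
  rw [theM, dif_pos h]
  exact h.choose_spec.1

instance DfnF.theM [Nonempty M] (P : E → M → Prop) [DfnP M fun p : E × M => P p.1 p.2] :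
    DfnF (fun e => theM (P e)) := by
  have := Coord.pair (M := M) (fun p : (E × M) × M => p.1.1) (fun p : (E × M) × M => p.2)
  have := DfnP.comp_coord (M := M) (fun p : E × M => P p.1 p.2)
    (fun p : (E × M) × M => (p.1.1, p.2))
  -- Where the description fails, `theM` returns a fixed element, which enters the formula as a
  -- parameter.
  refine ⟨DfnP.of_iff (fun p : E × M => ((∃! x, P p.1 x) ∧ P p.1 p.2) ∨
    (¬ (∃! x, P p.1 x) ∧ p.2 = Classical.arbitrary M)) fun p => ?_⟩
  by_cases h : ∃! x, P p.1 x
  · have := theM_spec h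
    simp only [h, not_true_eq_false, false_and, or_false, true_and]
    exact ⟨fun e => e ▸ this, fun e => h.unique e this⟩
  · simp [h, ZFModel.theM]

/-! ### Definability of the set-theoretic vocabulary -/

instance : Def2 (M := M) Subset := ⟨by unfold Subset; infer_instance⟩
instance : Def1 (M := M) IsEmptySet := ⟨by unfold IsEmptySet; infer_instance⟩
instance : Def3 (M := M) IsUPair := ⟨by unfold IsUPair; infer_instance⟩
instance : Def3 (M := M) IsOPair := ⟨by unfold IsOPair; infer_instance⟩
instance : Def2 (M := M) IsUnion := ⟨by unfold IsUnion; infer_instance⟩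
instance : Def2 (M := M) IsPowerset := ⟨by unfold IsPowerset; infer_instance⟩
instance : Def2 (M := M) IsSucc := ⟨by unfold IsSucc; infer_instance⟩
instance : Def1 (M := M) IsInductive := ⟨by unfold IsInductive; infer_instance⟩
instance : Def1 (M := M) IsOmega := ⟨by unfold IsOmega; infer_instance⟩
instance : Def3 (M := M) App := ⟨by unfold App; infer_instance⟩
instance : Def3 (M := M) IsFun := ⟨by unfold IsFun; infer_instance⟩
instance : Def3 (M := M) IsInj := ⟨by unfold IsInj; infer_instance⟩
instance : Def3 (M := M) IsBij := ⟨by unfold IsBij; infer_instance⟩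
instance : Def1 (M := M) IsFinite := ⟨by unfold IsFinite; infer_instance⟩

end Closure

/-! ### Basic set theory inside a model -/

/-- `M` is a model of `ZF`. -/
class ZF (M : Type u) [setLang.Structure M] : Prop where
  ax : IsModelZF M

section Basic

set_option linter.unusedSectionVars false

variable {M : Type u} [setLang.Structure M] [hZF : ZF M] {E : Type u} [Ctx M E]

instance : Nonempty M := let ⟨w, _⟩ := hZF.ax.infinity; ⟨w⟩

theorem ext {x y : M} (h : ∀ z, z ∈ₘ x ↔ z ∈ₘ y) : x = y := hZF.ax.extensionality x y h

/-- By extensionality a set is determined by its members, so existence alone makes the description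
unique. -/
theorem theM_set {P : M → Prop} {Q : M → Prop} (hP : ∀ b, P b ↔ ∀ x, x ∈ₘ b ↔ Q x)
    (h : ∃ b, P b) (x : M) : x ∈ₘ theM P ↔ Q x := by
  obtain ⟨b, hb⟩ := h
  rw [theM_eq (P := P) hb fun y hy => ext fun z => ((hP y).1 hy z).trans ((hP b).1 hb z).symm]
  exact (hP b).1 hb x

/-- `{x ∈ a | P x}` -/
noncomputable def sep (a : M) (P : M → Prop) : M := theM fun b => ∀ x, x ∈ₘ b ↔ x ∈ₘ a ∧ P x

instance DfnF.sep (f : E → M) (P : E → M → Prop) [DfnF f] [DfnP M fun p : E × M => P p.1 p.2] :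
    DfnF (fun e => sep (f e) (P e)) := by
  have := DfnF.comp_coord f (fun p : E × M => p.1)
  have := DfnF.comp_coord f (fun p : (E × M) × M => p.1.1)
  have := Coord.pair (M := M) (fun p : (E × M) × M => p.1.1) (fun p : (E × M) × M => p.2)
  have := DfnP.comp_coord (M := M) (fun p : E × M => P p.1 p.2)
    (fun p : (E × M) × M => (p.1.1, p.2))
  unfold ZFModel.sep
  infer_instance

@[simp] theorem mem_sep {a : M} {P : M → Prop} [hP : DfnP M P] {x : M} :
    x ∈ₘ sep a P ↔ x ∈ₘ a ∧ P x := by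
  refine theM_set (fun _ => Iff.rfl) ?_ x
  obtain ⟨n, p, φ, hφ⟩ := hP.out
  -- In the separation schema the tested element is variable `0`, so the parameters move up by one.
  obtain ⟨b, hb⟩ := hZF.ax.separation n (φ.relabel (Sum.elim Fin.succ fun _ => 0)) p a
  refine ⟨b, fun x => ?_⟩
  rw [hb, Language.Formula.realize_relabel, ← show Ctx.dec (fun _ : Unit => x) = x from rfl, ← hφ]
  have : (Fin.cons x p : Fin (n + 1) → M) ∘ Sum.elim Fin.succ (fun _ : Unit => 0) =
      Sum.elim p fun _ => x := by
    ext i; rcases i with i | i <;> rfl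
  rw [← this]
  rfl

/-- `{F x | x ∈ a}` -/
noncomputable def img (a : M) (F : M → M) : M := theM fun b => ∀ y, y ∈ₘ b ↔ ∃ x, x ∈ₘ a ∧ y = F x

instance DfnF.img (f : E → M) (F : E → M → M) [DfnF f] [DfnF fun p : E × M => F p.1 p.2] :
    DfnF (fun e => img (f e) (F e)) := by
  have := DfnF.comp_coord f (fun p : ((E × M) × M) × M => p.1.1.1)
  have := Coord.pair (M := M) (fun p : ((E × M) × M) × M => p.1.1.1)
    (fun p : ((E × M) × M) × M => p.2)
  have := DfnF.comp_coord (fun p : E × M => F p.1 p.2)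
    (fun p : ((E × M) × M) × M => (p.1.1.1, p.2))
  unfold ZFModel.img
  infer_instance

@[simp] theorem mem_img {a : M} {F : M → M} [hF : DfnF F] {y : M} :
    y ∈ₘ img a F ↔ ∃ x, x ∈ₘ a ∧ y = F x := by
  refine theM_set (fun _ => Iff.rfl) ?_ y
  obtain ⟨n, p, φ, hφ⟩ := hF.out.out
  have key : ∀ x y, (φ.relabel (Sum.elim (fun i => i.succ.succ)
      (Sum.elim (fun _ => 0) fun _ => 1) : _ → Fin (n + 2))).Realize
      (Fin.cons x (Fin.cons y p : Fin (n + 1) → M) : Fin (n + 2) → M) ↔ y = F x := fun x y => by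
    rw [Language.Formula.realize_relabel]
    have : (Fin.cons x (Fin.cons y p : Fin (n + 1) → M) : Fin (n + 2) → M) ∘
        (Sum.elim (fun i => i.succ.succ) (Sum.elim (fun _ => 0) fun _ => 1) :
          Fin n ⊕ Ctx.idx M (M × M) → Fin (n + 2)) =
        Sum.elim p (Sum.elim (fun _ => x) fun _ => y) := by
      ext i; rcases i with i | i | i <;> rfl
    rw [this]
    exact hφ (Sum.elim (fun _ : Unit => x) fun _ : Unit => y)
  obtain ⟨b, hb⟩ := hZF.ax.replacement n _ p a (fun x y y' _ h h' =>
    ((key x y).1 h).trans ((key x y').1 h').symm)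
  exact ⟨b, fun y => by simp only [hb, key]⟩

/-- `∅` -/
noncomputable def emp : M := theM IsEmptySet

@[simp] theorem notMem_emp (x : M) : ¬ x ∈ₘ emp := by
  refine (theM_set (P := IsEmptySet) (Q := fun _ => False) (fun b => by simp [IsEmptySet])
    ⟨sep (Classical.arbitrary M) fun _ => False, fun x => by simp⟩ x).1

theorem eq_emp {x : M} (h : ∀ z, ¬ z ∈ₘ x) : x = emp := ext fun z => by simp [h]

theorem isEmptySet_iff {x : M} : IsEmptySet x ↔ x = emp :=
  ⟨fun h => eq_emp h, fun h => by subst h; exact notMem_emp⟩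

theorem exists_mem {x : M} (h : x ≠ emp) : ∃ z, z ∈ₘ x := by
  by_contra! h'; exact h (eq_emp h')

theorem ne_emp {x z : M} (h : z ∈ₘ x) : x ≠ emp := by
  rintro rfl; exact notMem_emp _ h

/-- `{a, b}` -/
noncomputable def upair (a b : M) : M := theM fun p => IsUPair p a b

instance : Fn2 (M := M) upair := ⟨by unfold upair; infer_instance⟩

@[simp] theorem mem_upair {a b x : M} : x ∈ₘ upair a b ↔ x = a ∨ x = b :=
  theM_set (fun _ => Iff.rfl) (hZF.ax.pairing a b) x

theorem isUPair_iff {p a b : M} : IsUPair p a b ↔ p = upair a b :=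
  ⟨fun h => ext fun z => by rw [h z, mem_upair], fun h z => by rw [h, mem_upair]⟩

/-- `⋃ a` -/
noncomputable def sUn (a : M) : M := theM fun u => IsUnion u a

instance : Fn1 (M := M) sUn := ⟨by unfold sUn; infer_instance⟩

@[simp] theorem mem_sUn {a x : M} : x ∈ₘ sUn a ↔ ∃ y, y ∈ₘ a ∧ x ∈ₘ y :=
  theM_set (fun _ => Iff.rfl) (hZF.ax.union a) x

theorem isUnion_iff {u a : M} : IsUnion u a ↔ u = sUn a :=
  ⟨fun h => ext fun z => by rw [h z, mem_sUn], fun h z => by rw [h, mem_sUn]⟩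

/-- `℘(a)` -/
noncomputable def pow (a : M) : M := theM fun u => IsPowerset u a

instance : Fn1 (M := M) pow := ⟨by unfold pow; infer_instance⟩

@[simp] theorem mem_pow {a x : M} : x ∈ₘ pow a ↔ Subset x a :=
  theM_set (fun _ => Iff.rfl) (hZF.ax.powerset a) x

theorem Subset.antisymm {x y : M} (h : Subset x y) (h' : Subset y x) : x = y :=
  ext fun z => ⟨h z, h' z⟩

theorem Subset.trans {x y z : M} (h : Subset x y) (h' : Subset y z) : Subset x z :=
  fun a ha => h' a (h a ha)

theorem Subset.rfl {x : M} : Subset x x := fun _ h => h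

/-- `a ∪ b` -/
noncomputable def cup (a b : M) : M := sUn (upair a b)

instance : Fn2 (M := M) cup := ⟨by unfold cup; infer_instance⟩

@[simp] theorem mem_cup {a b x : M} : x ∈ₘ cup a b ↔ x ∈ₘ a ∨ x ∈ₘ b := by simp [cup]

/-- `a ∪ {b}` -/
noncomputable def ins (a b : M) : M := cup a (upair b b)

instance : Fn2 (M := M) ins := ⟨by unfold ins; infer_instance⟩

@[simp] theorem mem_ins {a b x : M} : x ∈ₘ ins a b ↔ x ∈ₘ a ∨ x = b := by simp [ins]

/-- `a ∖ {b}` -/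
noncomputable def del (a b : M) : M := sep a fun x => ¬ x = b

instance : Fn2 (M := M) del := ⟨by unfold del; infer_instance⟩

@[simp] theorem mem_del {a b x : M} : x ∈ₘ del a b ↔ x ∈ₘ a ∧ ¬ x = b := by simp [del]

theorem ins_eq_self {a b : M} (h : b ∈ₘ a) : ins a b = a :=
  ext fun z => by
    rw [mem_ins]
    exact ⟨fun hz => hz.elim id fun e => e ▸ h, Or.inl⟩

theorem del_ins {a b : M} (h : ¬ b ∈ₘ a) : del (ins a b) b = a :=
  ext fun z => by
    rw [mem_del, mem_ins]
    exact ⟨fun hz => hz.1.resolve_right hz.2, fun hz => ⟨Or.inl hz, fun e => h (e ▸ hz)⟩⟩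

theorem ins_del {a b : M} (h : b ∈ₘ a) : ins (del a b) b = a :=
  ext fun z => by
    rw [mem_ins, mem_del]
    by_cases hz : z = b
    · simp [hz, h]
    · simp [hz]

/-- `(a, b)` -/
noncomputable def opair (a b : M) : M := upair (upair a a) (upair a b)

instance : Fn2 (M := M) opair := ⟨by unfold opair; infer_instance⟩

theorem isOPair_iff {p a b : M} : IsOPair p a b ↔ p = opair a b := by
  simp [IsOPair, isUPair_iff, opair]

@[simp] theorem upair_inj_left {a b c : M} : upair a b = upair a c ↔ b = c := by
  refine ⟨fun h => ?_, fun h => by rw [h]⟩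
  have h1 : b ∈ₘ upair a c := h ▸ mem_upair.2 (Or.inr rfl)
  have h2 : c ∈ₘ upair a b := h ▸ mem_upair.2 (Or.inr rfl)
  rw [mem_upair] at h1 h2
  rcases h1 with h1 | h1
  · rcases h2 with h2 | h2 <;> simp [h1, h2]
  · exact h1

@[simp] theorem opair_inj {a b c d : M} : opair a b = opair c d ↔ a = c ∧ b = d := by
  refine ⟨fun h => ?_, fun h => by rw [h.1, h.2]⟩
  have h1 : upair c c ∈ₘ opair a b := h ▸ mem_upair.2 (Or.inl rfl)
  have hac : a = c := by
    rcases mem_upair.1 h1 with h1 | h1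
    · have : a ∈ₘ upair c c := h1 ▸ mem_upair.2 (Or.inl rfl)
      simpa using this
    · have : a ∈ₘ upair c c := h1 ▸ mem_upair.2 (Or.inl rfl)
      simpa using this
  subst hac
  simpa [opair] using h

theorem app_iff {f x y : M} : App f x y ↔ opair x y ∈ₘ f := by
  simp [App, isOPair_iff]

/-- `f(x)` -/
noncomputable def val (f x : M) : M := theM fun y => App f x y

instance : Fn2 (M := M) val := ⟨by unfold val; infer_instance⟩

theorem IsFun.app_val {f a b x : M} (h : IsFun f a b) (hx : x ∈ₘ a) : App f x (val f x) :=
  theM_spec (h.2 x hx)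

theorem IsFun.mem_of_app {f a b x y : M} (h : IsFun f a b) (hxy : App f x y) :
    x ∈ₘ a ∧ y ∈ₘ b := by
  obtain ⟨x', y', hx, hy, hp⟩ := h.1 _ (app_iff.1 hxy)
  rw [isOPair_iff, opair_inj] at hp
  exact ⟨hp.1 ▸ hx, hp.2 ▸ hy⟩

theorem IsFun.app_iff {f a b x y : M} (h : IsFun f a b) : App f x y ↔ x ∈ₘ a ∧ y = val f x :=
  ⟨fun hxy => ⟨(h.mem_of_app hxy).1, (h.2 x (h.mem_of_app hxy).1).unique hxy
    (h.app_val (h.mem_of_app hxy).1)⟩, fun ⟨hx, e⟩ => e ▸ h.app_val hx⟩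

theorem IsFun.val_mem {f a b x : M} (h : IsFun f a b) (hx : x ∈ₘ a) : val f x ∈ₘ b :=
  (h.mem_of_app (h.app_val hx)).2

theorem IsInj.val_inj {f a b x y : M} (h : IsInj f a b) (hx : x ∈ₘ a) (hy : y ∈ₘ a)
    (e : val f x = val f y) : x = y :=
  h.2 x y (val f x) (h.1.app_val hx) (e ▸ h.1.app_val hy)

/-- The function `x ↦ F x` on `a`, as a set of ordered pairs. -/
noncomputable def gr (a : M) (F : M → M) : M := img a fun x => opair x (F x)

theorem app_gr {a : M} {F : M → M} [DfnF F] {x y : M} : App (gr a F) x y ↔ x ∈ₘ a ∧ y = F x := by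
  rw [ZFModel.app_iff, gr, mem_img]
  simp only [opair_inj]
  constructor
  · rintro ⟨z, hz, rfl, rfl⟩; exact ⟨hz, rfl⟩
  · rintro ⟨hx, rfl⟩; exact ⟨x, hx, rfl, rfl⟩

theorem isFun_gr {a b : M} {F : M → M} [DfnF F] (h : ∀ x, x ∈ₘ a → F x ∈ₘ b) :
    IsFun (gr a F) a b := by
  refine ⟨fun p hp => ?_, fun x hx => ⟨F x, app_gr.2 ⟨hx, rfl⟩, fun y hy => (app_gr.1 hy).2⟩⟩
  rw [gr, mem_img] at hp
  obtain ⟨x, hx, rfl⟩ := hp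
  exact ⟨x, F x, hx, h x hx, isOPair_iff.2 rfl⟩

theorem isInj_gr {a b : M} {F : M → M} [DfnF F] (h : ∀ x, x ∈ₘ a → F x ∈ₘ b)
    (hi : ∀ x y, x ∈ₘ a → y ∈ₘ a → F x = F y → x = y) : IsInj (gr a F) a b := by
  refine ⟨isFun_gr h, fun x x' y hx hx' => ?_⟩
  rw [app_gr] at hx hx'
  exact hi x x' hx.1 hx'.1 (hx.2 ▸ hx'.2)

/-! ### The natural numbers -/

/-- `n ∪ {n}` -/
noncomputable def suc (n : M) : M := ins n n

instance : Fn1 (M := M) suc := ⟨by unfold suc; infer_instance⟩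

@[simp] theorem mem_suc {n x : M} : x ∈ₘ suc n ↔ x ∈ₘ n ∨ x = n := mem_ins

theorem isSucc_iff {s x : M} : IsSucc s x ↔ s = suc x :=
  ⟨fun h => ext fun z => by rw [h z, mem_suc], fun h z => by rw [h, mem_suc]⟩

theorem isInductive_iff {w : M} :
    IsInductive w ↔ emp ∈ₘ w ∧ ∀ x, x ∈ₘ w → suc x ∈ₘ w := by
  simp [IsInductive, isEmptySet_iff, isSucc_iff]

/-- `ω` -/
noncomputable def om : M := theM IsOmega

theorem isOmega_om : IsOmega (om : M) := by
  obtain ⟨w, hw⟩ := hZF.ax.infinity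
  refine theM_spec ⟨sep w fun x => ∀ v, IsInductive v → x ∈ₘ v, ⟨?_, ?_⟩, ?_⟩
  · rw [isInductive_iff] at hw ⊢
    simp only [mem_sep]
    exact ⟨⟨hw.1, fun v hv => (isInductive_iff.1 hv).1⟩,
      fun x hx => ⟨hw.2 x hx.1, fun v hv => (isInductive_iff.1 hv).2 x (hx.2 v hv)⟩⟩
  · intro v hv x hx
    exact (mem_sep.1 hx).2 v hv
  · intro y hy
    refine Subset.antisymm (fun x hx => mem_sep.2 ⟨hy.2 w hw x hx, fun v hv => hy.2 v hv x hx⟩)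
      fun x hx => (mem_sep.1 hx).2 y hy.1

theorem isOmega_iff {w : M} : IsOmega w ↔ w = om :=
  ⟨fun h => Subset.antisymm (h.2 _ isOmega_om.1) (isOmega_om.2 _ h.1), fun h => h ▸ isOmega_om⟩

@[simp] theorem emp_mem_om : (emp : M) ∈ₘ om := (isInductive_iff.1 isOmega_om.1).1

theorem suc_mem_om {n : M} (h : n ∈ₘ om) : suc n ∈ₘ om := (isInductive_iff.1 isOmega_om.1).2 n h

/-- Definability of `P` is essential: induction is minimality of `ω` among the inductive sets of
`M`, applied to `{n ∈ ω | P n}`. -/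
theorem om_induction (P : M → Prop) [DfnP M P] (h0 : P emp)
    (hs : ∀ n, n ∈ₘ om → P n → P (suc n)) {n : M} (hn : n ∈ₘ om) : P n := by
  have : IsInductive (sep om P) := by
    rw [isInductive_iff]
    simp only [mem_sep]
    exact ⟨⟨emp_mem_om, h0⟩, fun x hx => ⟨suc_mem_om hx.1, hs x hx.1 hx.2⟩⟩
  exact (mem_sep.1 (isOmega_om.2 _ this n hn)).2

/-- Foundation applied to `{y ∈ a | P y}`. For numbers this is the least number principle. -/
theorem exists_minimal {P : M → Prop} [DfnP M P] {a x : M} (hx : x ∈ₘ a) (h : P x) :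
    ∃ m, m ∈ₘ a ∧ P m ∧ ∀ k, k ∈ₘ m → k ∈ₘ a → ¬ P k := by
  obtain ⟨y, hy, hmin⟩ := hZF.ax.foundation (sep a P)
    (fun he => he x (mem_sep.2 ⟨hx, h⟩))
  rw [mem_sep] at hy
  exact ⟨y, hy.1, hy.2, fun k hk hka hP => hmin ⟨k, hk, mem_sep.2 ⟨hka, hP⟩⟩⟩

theorem notMem_self (x : M) : ¬ x ∈ₘ x := by
  intro h
  obtain ⟨m, hm, hmx, hk⟩ := exists_minimal (P := fun y => y = x) (a := x) h rfl
  subst hmx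
  exact hk m hm hm rfl

theorem notMem_of_mem {x y : M} (h : x ∈ₘ y) : ¬ y ∈ₘ x := by
  intro h'
  obtain ⟨m, hm, -, hk⟩ := exists_minimal (P := fun z => z = x ∨ z = y) (a := upair x y)
    (x := x) (by simp) (Or.inl rfl)
  rcases mem_upair.1 hm with rfl | rfl
  · exact hk y h' (by simp) (Or.inr rfl)
  · exact hk x h (by simp) (Or.inl rfl)

theorem suc_inj {m n : M} (h : suc m = suc n) : m = n := by
  have h1 : m ∈ₘ suc n := h ▸ mem_suc.2 (Or.inr rfl)
  have h2 : n ∈ₘ suc m := h ▸ mem_suc.2 (Or.inr rfl)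
  rw [mem_suc] at h1 h2
  rcases h1 with h1 | h1
  · rcases h2 with h2 | h2
    · exact (notMem_of_mem h1 h2).elim
    · exact h2.symm
  · exact h1

theorem suc_ne_emp (n : M) : suc n ≠ emp := ne_emp (mem_suc.2 (Or.inr rfl))

theorem om_trans {m n : M} (hm : m ∈ₘ n) (hn : n ∈ₘ om) : m ∈ₘ om := by
  refine om_induction (fun n => ∀ m, m ∈ₘ n → m ∈ₘ om) (by simp) (fun n hn ih m hm => ?_) hn m hm
  rcases mem_suc.1 hm with h | rfl
  · exact ih m h
  · exact hn

theorem mem_trans {k m n : M} (hkm : k ∈ₘ m) (hm : m ∈ₘ n) (hn : n ∈ₘ om) : k ∈ₘ n := by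
  refine om_induction (fun n => ∀ k m, k ∈ₘ m → m ∈ₘ n → k ∈ₘ n) (by simp)
    (fun n hn ih k m hkm hm => ?_) hn k m hkm hm
  rcases mem_suc.1 hm with h | rfl
  · exact mem_suc.2 (Or.inl (ih k m hkm h))
  · exact mem_suc.2 (Or.inl hkm)

theorem om_cases {n : M} (hn : n ∈ₘ om) : n = emp ∨ ∃ m, m ∈ₘ om ∧ n = suc m :=
  om_induction (fun n => n = emp ∨ ∃ m, m ∈ₘ om ∧ n = suc m) (Or.inl rfl)
    (fun n hn _ => Or.inr ⟨n, hn, rfl⟩) hn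

theorem emp_mem_suc {n : M} (hn : n ∈ₘ om) : emp ∈ₘ suc n :=
  om_induction (fun n => emp ∈ₘ suc n) (by simp) (fun n _ ih => mem_suc.2 (Or.inl ih)) hn

theorem suc_mem_suc {m n : M} (hn : n ∈ₘ om) (h : m ∈ₘ n) : suc m ∈ₘ suc n := by
  refine om_induction (fun n => ∀ m, m ∈ₘ n → suc m ∈ₘ suc n) (by simp) (fun n hn ih m hm => ?_) hn
    m h
  rcases mem_suc.1 hm with h | rfl
  · exact mem_suc.2 (Or.inl (ih m h))
  · exact mem_suc.2 (Or.inr rfl)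

theorem trichotomy {m n : M} (hm : m ∈ₘ om) (hn : n ∈ₘ om) : m ∈ₘ n ∨ m = n ∨ n ∈ₘ m := by
  refine om_induction (fun n => ∀ m, m ∈ₘ om → m ∈ₘ n ∨ m = n ∨ n ∈ₘ m) (fun m hm => ?_)
    (fun n hn ih m hm => ?_) hn m hm
  · rcases om_cases hm with rfl | ⟨k, hk, rfl⟩
    · simp
    · exact Or.inr (Or.inr (emp_mem_suc hk))
  · rcases ih m hm with h | rfl | h
    · exact Or.inl (mem_suc.2 (Or.inl h))
    · exact Or.inl (mem_suc.2 (Or.inr rfl))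
    · rcases mem_suc.1 (suc_mem_suc hm h) with h | h
      · exact Or.inr (Or.inr h)
      · exact Or.inr (Or.inl h.symm)

/-! ### Recursion on the natural numbers -/

/-- `t` is a set of pairs closed under predecessors of the recursion `0 ↦ a`, `n + 1 ↦ G n y`. -/
def IsDer (a : M) (G : M → M → M) (t : M) : Prop :=
  ∀ p, p ∈ₘ t → p = opair emp a ∨ ∃ j z, j ∈ₘ om ∧ opair j z ∈ₘ t ∧ p = opair (suc j) (G j z)

/-- The sequence with `0 ↦ a` and `n + 1 ↦ G n y`. -/
noncomputable def recM (a : M) (G : M → M → M) (n : M) : M :=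
  theM fun y => ∃ t, IsDer a G t ∧ opair n y ∈ₘ t

section Rec

variable {a : M} {G : M → M → M} [hG : Fn2 G]

instance : Def1 (IsDer a G) := ⟨by unfold IsDer; infer_instance⟩

instance : Fn1 (recM a G) := ⟨by unfold recM; infer_instance⟩

/-- A derivation need not be a function: since each of its pairs is justified by a pair one step
earlier, induction on `n` already forces the value at `n`. -/
theorem recM_existsUnique {n : M} (hn : n ∈ₘ om) : ∃! y, ∃ t, IsDer a G t ∧ opair n y ∈ₘ t := by
  refine om_induction (fun n => ∃! y, ∃ t, IsDer a G t ∧ opair n y ∈ₘ t) ?_ ?_ hn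
  · refine ⟨a, ⟨ins emp (opair emp a), fun p hp => Or.inl (by simpa using hp), by simp⟩, ?_⟩
    rintro y ⟨t, ht, hy⟩
    rcases ht _ hy with h | ⟨j, z, -, -, h⟩
    · exact (opair_inj.1 h).2
    · exact (suc_ne_emp j (opair_inj.1 h).1.symm).elim
  · rintro n hn ⟨y, ⟨t, ht, hy⟩, huniq⟩
    -- A derivation reaching `n` is prolonged by the one pair that it justifies.
    refine ⟨G n y, ⟨ins t (opair (suc n) (G n y)), fun p hp => ?_, by simp⟩, ?_⟩
    · rcases mem_ins.1 hp with hp | rfl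
      · refine (ht p hp).imp id ?_
        rintro ⟨j, z, hj, hz, rfl⟩
        exact ⟨j, z, hj, mem_ins.2 (Or.inl hz), rfl⟩
      · exact Or.inr ⟨n, y, hn, mem_ins.2 (Or.inl hy), rfl⟩
    · rintro y' ⟨t', ht', hy'⟩
      rcases ht' _ hy' with h | ⟨j, z, -, hz, h⟩
      · exact (suc_ne_emp n (opair_inj.1 h).1).elim
      · obtain ⟨h1, rfl⟩ := opair_inj.1 h
        obtain rfl := suc_inj h1
        rw [huniq z ⟨t', ht', hz⟩]

theorem recM_zero : recM a G emp = a :=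
  theM_eq ⟨ins emp (opair emp a), fun p hp => Or.inl (by simpa using hp), by simp⟩
    fun y hy => (recM_existsUnique (a := a) (G := G) emp_mem_om).unique hy
      ⟨ins emp (opair emp a), fun p hp => Or.inl (by simpa using hp), by simp⟩

theorem recM_suc {n : M} (hn : n ∈ₘ om) : recM a G (suc n) = G n (recM a G n) := by
  obtain ⟨t, ht, hy⟩ : ∃ t, IsDer a G t ∧ opair n (recM a G n) ∈ₘ t :=
    theM_spec (recM_existsUnique (a := a) (G := G) hn)
  have : ∃ t, IsDer a G t ∧ opair (suc n) (G n (recM a G n)) ∈ₘ t := by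
    refine ⟨ins t (opair (suc n) (G n (recM a G n))), fun p hp => ?_, by simp⟩
    rcases mem_ins.1 hp with hp | rfl
    · refine (ht p hp).imp id ?_
      rintro ⟨j, z, hj, hz, rfl⟩
      exact ⟨j, z, hj, mem_ins.2 (Or.inl hz), rfl⟩
    · exact Or.inr ⟨n, _, hn, mem_ins.2 (Or.inl hy), rfl⟩
  exact theM_eq this fun y hy => (recM_existsUnique (suc_mem_om hn)).unique hy this

end Rec

end Basic

/-! ### Finite sets inside a model -/

section Finite

set_option linter.unusedSectionVars false

variable {M : Type u} [setLang.Structure M] [hZF : ZF M]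

theorem isFinite_iff {x : M} : IsFinite x ↔ ∃ n f, n ∈ₘ om ∧ IsBij f n x := by
  simp [IsFinite, isOmega_iff]

theorem isFinite_emp : IsFinite (emp : M) :=
  isFinite_iff.2 ⟨emp, gr emp fun x => x, by simp, isInj_gr (by simp) (by simp), by simp⟩

theorem app_ins {f n a x y : M} : App (ins f (opair n a)) x y ↔ App f x y ∨ (x = n ∧ y = a) := by
  simp [app_iff]

theorem IsFinite.ins {x : M} (hx : IsFinite x) (a : M) : IsFinite (ins x a) := by
  by_cases ha : a ∈ₘ x
  · rwa [ins_eq_self ha]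
  obtain ⟨n, f, hn, hf, hsurj⟩ := isFinite_iff.1 hx
  have hA : ∀ {y z}, App f y z → y ∈ₘ n ∧ z ∈ₘ x := fun h => hf.1.mem_of_app h
  refine isFinite_iff.2 ⟨suc n, ZFModel.ins f (opair n a), suc_mem_om hn,
    ⟨⟨fun p hp => ?_, fun y hy => ?_⟩, ?_⟩, fun z hz => ?_⟩
  · rcases mem_ins.1 hp with hp | rfl
    · obtain ⟨y, z, hy, hz, h⟩ := hf.1.1 p hp
      exact ⟨y, z, mem_suc.2 (Or.inl hy), mem_ins.2 (Or.inl hz), h⟩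
    · exact ⟨n, a, by simp, by simp, isOPair_iff.2 rfl⟩
  · rcases mem_suc.1 hy with hy | rfl
    · refine ⟨val f y, app_ins.2 (Or.inl (hf.1.app_val hy)), fun z hz => ?_⟩
      rcases app_ins.1 hz with h | ⟨rfl, -⟩
      · exact (hf.1.app_iff.1 h).2
      · exact (notMem_self _ hy).elim
    · refine ⟨a, app_ins.2 (Or.inr ⟨rfl, rfl⟩), fun z hz => ?_⟩
      rcases app_ins.1 hz with h | ⟨-, h⟩
      · exact (notMem_self _ (hA h).1).elim
      · exact h
  · intro y y' z hy hy'
    rcases app_ins.1 hy with h | ⟨rfl, rfl⟩ <;> rcases app_ins.1 hy' with h' | ⟨rfl, h'⟩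
    · exact hf.2 _ _ _ h h'
    · exact (ha (h' ▸ (hA h).2)).elim
    · exact (ha (hA h').2).elim
    · rfl
  · rcases mem_ins.1 hz with hz | rfl
    · obtain ⟨y, hy, h⟩ := hsurj z hz
      exact ⟨y, mem_suc.2 (Or.inl hy), app_ins.2 (Or.inl h)⟩
    · exact ⟨n, by simp, app_ins.2 (Or.inr ⟨rfl, rfl⟩)⟩

theorem img_ins {x a : M} {F : M → M} [DfnF F] : img (ins x a) F = ins (img x F) (F a) :=
  ext fun z => by
    simp only [mem_img, mem_ins]
    constructor
    · rintro ⟨y, hy | rfl, rfl⟩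
      · exact Or.inl ⟨y, hy, rfl⟩
      · exact Or.inr rfl
    · rintro (⟨y, hy, rfl⟩ | rfl)
      · exact ⟨y, Or.inl hy, rfl⟩
      · exact ⟨a, Or.inr rfl, rfl⟩

theorem img_emp {F : M → M} [DfnF F] : img emp F = emp := eq_emp (by simp)

/-- An enumeration of `x` builds it up one point at a time, which turns induction on `ω` into
induction on finite sets. -/
theorem fin_induction (P : M → Prop) [hP : DfnP M P] (h0 : P emp)
    (hs : ∀ x a, IsFinite x → ¬ a ∈ₘ x → P x → P (ins x a)) {x : M} (hx : IsFinite x) : P x := by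
  obtain ⟨n, f, hn, hf, hsurj⟩ := isFinite_iff.1 hx
  have : Def1 P := ⟨hP⟩
  -- This is proved for all numbers, even beyond the domain of `f`: there `val f` is still a
  -- definable function, and a repeated value adds nothing to the image.
  have key : IsFinite (img n (val f)) ∧ P (img n (val f)) := by
    refine om_induction (fun n => IsFinite (img n (val f)) ∧ P (img n (val f)))
      (by rw [img_emp]; exact ⟨isFinite_emp, h0⟩) (fun n _ ih => ?_) hn
    rw [suc, img_ins]
    refine ⟨ih.1.ins _, ?_⟩
    by_cases h : val f n ∈ₘ img n (val f)
    · rw [ins_eq_self h]; exact ih.2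
    · exact hs _ _ ih.1 h ih.2
  have hx : x = img n (val f) := ext fun z => by
    rw [mem_img]
    constructor
    · intro hz
      obtain ⟨y, hy, h⟩ := hsurj z hz
      exact ⟨y, hy, (hf.1.app_iff.1 h).2⟩
    · rintro ⟨y, hy, rfl⟩
      exact hf.1.val_mem hy
  rw [hx]
  exact key.2

theorem IsFinite.subset {x y : M} (hx : IsFinite x) (h : Subset y x) : IsFinite y := by
  refine fin_induction (fun x => ∀ y, Subset y x → IsFinite y) (fun y hy => ?_)
    (fun x a _ _ ih y hy => ?_) hx y h
  · rw [eq_emp fun z hz => notMem_emp z (hy z hz)]; exact isFinite_emp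
  · have hd : IsFinite (del y a) := ih _ fun z hz => by
      rw [mem_del] at hz
      exact (mem_ins.1 (hy z hz.1)).resolve_right hz.2
    by_cases ha : a ∈ₘ y
    · rw [← ins_del ha]; exact hd.ins a
    · refine ih y fun z hz => (mem_ins.1 (hy z hz)).resolve_right ?_
      rintro rfl; exact ha hz

theorem cup_emp {x : M} : cup x emp = x := ext fun z => by simp

theorem cup_ins {x y a : M} : cup x (ins y a) = ins (cup x y) a := ext fun z => by simp [or_assoc]

theorem IsFinite.cup {x y : M} (hx : IsFinite x) (hy : IsFinite y) : IsFinite (cup x y) := by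
  refine fin_induction (fun y => IsFinite (ZFModel.cup x y)) (by rwa [cup_emp])
    (fun y a _ _ ih => ?_) hy
  rw [cup_ins]; exact ih.ins a

theorem IsFinite.img {x : M} (hx : IsFinite x) {F : M → M} [hF : DfnF F] :
    IsFinite (img x F) := by
  have : Fn1 F := ⟨hF⟩
  refine fin_induction (fun x => IsFinite (ZFModel.img x F)) (by rw [img_emp]; exact isFinite_emp)
    (fun y a _ _ ih => ?_) hx
  rw [img_ins]; exact ih.ins _

theorem sUn_emp : sUn (emp : M) = emp := eq_emp (by simp)

theorem sUn_ins {x a : M} : sUn (ins x a) = cup (sUn x) a := ext fun z => by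
  simp only [mem_sUn, mem_ins, mem_cup]
  constructor
  · rintro ⟨y, hy | rfl, hz⟩
    · exact Or.inl ⟨y, hy, hz⟩
    · exact Or.inr hz
  · rintro (⟨y, hy, hz⟩ | hz)
    · exact ⟨y, Or.inl hy, hz⟩
    · exact ⟨a, Or.inr rfl, hz⟩

theorem IsFinite.sUn {x : M} (hx : IsFinite x) (h : ∀ y, y ∈ₘ x → IsFinite y) :
    IsFinite (sUn x) := by
  refine fin_induction (fun x => (∀ y, y ∈ₘ x → IsFinite y) → IsFinite (ZFModel.sUn x))
    (by rw [sUn_emp]; exact fun _ => isFinite_emp) (fun y a _ _ ih h => ?_) hx h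
  rw [sUn_ins]
  exact (ih fun z hz => h z (mem_ins.2 (Or.inl hz))).cup (h a (by simp))

theorem IsFinite.pow {x : M} (hx : IsFinite x) : IsFinite (pow x) := by
  refine fin_induction (fun x => IsFinite (ZFModel.pow x)) ?_ (fun x a _ _ ih => ?_) hx
  · refine (isFinite_emp.ins emp).subset fun z hz => ?_
    rw [mem_pow] at hz
    exact mem_ins.2 (Or.inr (eq_emp fun y hy => notMem_emp y (hz y hy)))
  -- A subset of `x ∪ {a}` is a subset of `x`, or one with `a` inserted.
  · refine (ih.cup (ih.img (F := fun y => ZFModel.ins y a))).subset fun z hz => ?_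
    rw [mem_pow] at hz
    rw [mem_cup, mem_img]
    by_cases ha : a ∈ₘ z
    · refine Or.inr ⟨del z a, mem_pow.2 fun y hy => ?_, (ins_del ha).symm⟩
      rw [mem_del] at hy
      exact (mem_ins.1 (hz y hy.1)).resolve_right hy.2
    · refine Or.inl (mem_pow.2 fun y hy => (mem_ins.1 (hz y hy)).resolve_right ?_)
      rintro rfl; exact ha hy

theorem isFinite_of_mem_om {n : M} (hn : n ∈ₘ om) : IsFinite n :=
  om_induction (fun n => IsFinite n) isFinite_emp (fun n _ ih => ih.ins n) hn

theorem IsFinite.bounded {x : M} (hx : IsFinite x) (h : Subset x om) :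
    ∃ n, n ∈ₘ om ∧ Subset x n := by
  refine fin_induction (fun x => Subset x om → ∃ n, n ∈ₘ om ∧ Subset x n)
    (fun _ => ⟨emp, by simp, fun z hz => hz⟩) (fun x a _ _ ih h => ?_) hx h
  obtain ⟨n, hn, hx⟩ := ih fun z hz => h z (mem_ins.2 (Or.inl hz))
  have ha : a ∈ₘ om := h a (by simp)
  have hle : ∀ {m k : M}, m ∈ₘ om → k ∈ₘ m ∨ k = m → Subset (suc k) (suc m) := fun hm hk z hz => by
    rcases hk with hk | rfl
    · rcases mem_suc.1 hz with h | rfl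
      · exact mem_suc.2 (Or.inl (mem_trans h hk hm))
      · exact mem_suc.2 (Or.inl hk)
    · exact hz
  rcases trichotomy ha hn with h' | h' | h'
  · refine ⟨suc n, suc_mem_om hn, fun z hz => ?_⟩
    rcases mem_ins.1 hz with hz | rfl
    · exact mem_suc.2 (Or.inl (hx z hz))
    · exact mem_suc.2 (Or.inl h')
  · refine ⟨suc n, suc_mem_om hn, fun z hz => ?_⟩
    rcases mem_ins.1 hz with hz | rfl
    · exact mem_suc.2 (Or.inl (hx z hz))
    · exact mem_suc.2 (Or.inr h')
  · refine ⟨suc a, suc_mem_om ha, fun z hz => ?_⟩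
    rcases mem_ins.1 hz with hz | rfl
    · exact mem_suc.2 (Or.inl (mem_trans (hx z hz) h' ha))
    · exact mem_suc.2 (Or.inr rfl)

theorem not_isFinite_om : ¬ IsFinite (om : M) := fun h => by
  obtain ⟨n, hn, hsub⟩ := h.bounded fun _ h => h
  exact notMem_self n (hsub n hn)

theorem isFinite_of_inj {a b : M} (hb : IsFinite b) (F : M → M) [hF : DfnF F]
    (h : ∀ x, x ∈ₘ a → F x ∈ₘ b)
    (hi : ∀ x y, x ∈ₘ a → y ∈ₘ a → F x = F y → x = y) : IsFinite a := by
  have : Fn1 F := ⟨hF⟩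
  -- `a` is covered by the image of `b` under the partial inverse of `F`. Points outside the range
  -- of `F` go to the default value of `theM`, so only an inclusion is claimed.
  refine (hb.img (F := fun y => theM fun x => x ∈ₘ a ∧ F x = y)).subset fun x hx => ?_
  exact mem_img.2 ⟨F x, h x hx, (theM_eq ⟨hx, rfl⟩ fun y hy => hi y x hy.1 hx hy.2).symm⟩

theorem isDedekindInfinite_iff {x : M} : IsDedekindInfinite x ↔ ∃ f, IsInj f om x := by
  simp [IsDedekindInfinite, isOmega_iff]

/-- `[x]^{<ω}` -/
noncomputable def fpow (x : M) : M := sep (pow x) fun y => IsFinite y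

instance : Fn1 (M := M) fpow := ⟨by unfold fpow; infer_instance⟩

@[simp] theorem mem_fpow {x y : M} : y ∈ₘ fpow x ↔ Subset y x ∧ IsFinite y := by simp [fpow]

theorem isFinPowerset_iff {P x : M} : IsFinPowerset P x ↔ P = fpow x :=
  ⟨fun h => ext fun z => by rw [h z, mem_fpow], fun h z => by rw [h, mem_fpow]⟩

theorem IsInj.mono {f a b c : M} (h : IsInj f a b) (hbc : Subset b c) : IsInj f a c :=
  ⟨⟨fun p hp => let ⟨x, y, hx, hy, h⟩ := h.1.1 p hp; ⟨x, y, hx, hbc y hy, h⟩, h.1.2⟩, h.2⟩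

/-! ### The two easy implications -/

theorem FinPowersetsDedekindInfinite.form82 (h : FinPowersetsDedekindInfinite M) : Form82 M := by
  intro X hX
  obtain ⟨P, hP, hD⟩ := h X hX
  obtain ⟨f, hf⟩ := isDedekindInfinite_iff.1 hD
  exact ⟨pow X, fun z => mem_pow,
    isDedekindInfinite_iff.2 ⟨f, hf.mono fun z hz => mem_pow.2 ((hP z).1 hz).1⟩⟩

theorem FinEqDFin.finPowersets (h : FinEqDFin M) : FinPowersetsDedekindInfinite M := by
  intro X hX
  refine ⟨fpow X, isFinPowerset_iff.2 rfl, h _ fun hfin => hX ?_⟩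
  refine isFinite_of_inj hfin (fun x => upair x x) (fun x hx => ?_) (fun x y _ _ h => ?_)
  · rw [mem_fpow]
    refine ⟨fun z hz => ?_, ?_⟩
    · simp only [mem_upair, or_self] at hz
      exact hz ▸ hx
    · have := (isFinite_emp (M := M)).ins x
      rwa [show ins emp x = upair x x from ext fun z => by simp] at this
  · have : x ∈ₘ upair y y := h ▸ mem_upair.2 (Or.inl rfl)
    simpa using this

end Finite

section Card

set_option linter.unusedSectionVars false

variable {M : Type u} [setLang.Structure M] [hZF : ZF M]

/-! ### Cardinalities of finite sets -/

/-- The set of subsets of `X` with exactly `n` elements. -/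
noncomputable def crd (X n : M) : M :=
  recM (upair emp emp)
    (fun _ C => sep (pow X) fun y => (∃ a, a ∈ₘ y) ∧ ∀ a, a ∈ₘ y → del y a ∈ₘ C) n

instance crd_step (X : M) : Fn2 (M := M)
    (fun _ C => sep (pow X) fun y => (∃ a, a ∈ₘ y) ∧ ∀ a, a ∈ₘ y → del y a ∈ₘ C) :=
  ⟨inferInstance⟩

instance (X : M) : Fn1 (crd X) := ⟨by unfold crd; infer_instance⟩

theorem mem_crd_emp {X x : M} : x ∈ₘ crd X emp ↔ x = emp := by
  rw [crd, recM_zero, mem_upair, or_self]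

theorem mem_crd_suc {X x n : M} (hn : n ∈ₘ om) : x ∈ₘ crd X (suc n) ↔
    Subset x X ∧ (∃ a, a ∈ₘ x) ∧ ∀ a, a ∈ₘ x → del x a ∈ₘ crd X n := by
  rw [crd, recM_suc hn, mem_sep, mem_pow]; rfl

/-- `crd` asks that the deletion of any point lowers the size by one. Deleting `a` from `x ∪ {a}`
gives back `x`; deleting another `b` commutes with inserting `a`, so induction applies. -/
theorem ins_mem_crd {X x a n : M} (hn : n ∈ₘ om) (h : x ∈ₘ crd X n) (haX : a ∈ₘ X)
    (ha : ¬ a ∈ₘ x) : ins x a ∈ₘ crd X (suc n) := by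
  refine om_induction (fun n => ∀ x, x ∈ₘ crd X n → ¬ a ∈ₘ x → ins x a ∈ₘ crd X (suc n))
    (fun x h ha => ?_) (fun n hn ih x h ha => ?_) hn x h ha
  · rw [mem_crd_emp] at h
    subst h
    simp only [mem_crd_suc emp_mem_om, mem_ins, mem_crd_emp]
    refine ⟨fun z hz => ?_, ⟨a, Or.inr rfl⟩, fun b hb => ?_⟩
    · rcases mem_ins.1 hz with hz | rfl
      · exact (notMem_emp z hz).elim
      · exact haX
    · obtain rfl : b = a := hb.resolve_left (notMem_emp b)
      exact del_ins (notMem_emp b)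
  · rw [mem_crd_suc (suc_mem_om hn)]
    refine ⟨fun z hz => ?_, ⟨a, mem_ins.2 (Or.inr rfl)⟩, fun b hb => ?_⟩
    · rcases mem_ins.1 hz with hz | rfl
      · exact ((mem_crd_suc hn).1 h).1 z hz
      · exact haX
    · by_cases e : b = a
      · subst e; rwa [del_ins ha]
      · have hbx : b ∈ₘ x := (mem_ins.1 hb).resolve_right e
        have := ih _ (((mem_crd_suc hn).1 h).2.2 b hbx) (fun h' => ha (mem_del.1 h').1)
        rwa [show ins (del x b) a = del (ins x a) b from ext fun z => by
          simp only [mem_ins, mem_del]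
          by_cases hz : z = a
          · subst hz; simp [Ne.symm e]
          · simp [hz] ] at this

theorem crd_unique {X x n m : M} (hn : n ∈ₘ om) (hm : m ∈ₘ om) (h : x ∈ₘ crd X n)
    (h' : x ∈ₘ crd X m) : n = m := by
  refine om_induction (fun n => ∀ m x, m ∈ₘ om → x ∈ₘ crd X n → x ∈ₘ crd X m → n = m)
    (fun m x hm h h' => ?_) (fun n hn ih m x hm h h' => ?_) hn m x hm h h'
  · rw [mem_crd_emp] at h
    subst h
    rcases om_cases hm with rfl | ⟨k, hk, rfl⟩
    · rfl
    · obtain ⟨a, ha⟩ := ((mem_crd_suc hk).1 h').2.1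
      exact (notMem_emp a ha).elim
  · obtain ⟨-, ⟨a, ha⟩, hd⟩ := (mem_crd_suc hn).1 h
    rcases om_cases hm with rfl | ⟨k, hk, rfl⟩
    · rw [mem_crd_emp] at h'
      subst h'
      exact (notMem_emp a ha).elim
    · rw [ih k _ hk (hd a ha) (((mem_crd_suc hk).1 h').2.2 a ha)]

theorem exists_crd {X x : M} (hx : IsFinite x) (h : Subset x X) : ∃ n, n ∈ₘ om ∧ x ∈ₘ crd X n := by
  refine fin_induction (fun x => Subset x X → ∃ n, n ∈ₘ om ∧ x ∈ₘ crd X n)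
    (fun _ => ⟨emp, emp_mem_om, mem_crd_emp.2 rfl⟩) (fun x a _ ha ih h => ?_) hx h
  obtain ⟨n, hn, hx⟩ := ih fun z hz => h z (mem_ins.2 (Or.inl hz))
  exact ⟨suc n, suc_mem_om hn, ins_mem_crd hn hx (h a (by simp)) ha⟩

/-- The number of elements of the finite subset `x` of `X`. -/
noncomputable def card (X x : M) : M := theM fun n => n ∈ₘ om ∧ x ∈ₘ crd X n

instance (X : M) : Fn1 (card X) := ⟨by unfold card; infer_instance⟩

theorem card_eq {X x n : M} (hn : n ∈ₘ om) (h : x ∈ₘ crd X n) : card X x = n :=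
  theM_eq ⟨hn, h⟩ fun _ hm => crd_unique hm.1 hn hm.2 h

theorem card_spec {X x : M} (h : x ∈ₘ fpow X) : card X x ∈ₘ om ∧ x ∈ₘ crd X (card X x) := by
  rw [mem_fpow] at h
  obtain ⟨n, hn, hx⟩ := exists_crd h.2 h.1
  rw [card_eq hn hx]
  exact ⟨hn, hx⟩

/-- `n ↦ 2 n` -/
noncomputable def dbl (n : M) : M := recM emp (fun _ y => suc (suc y)) n

instance dbl_step : Fn2 (M := M) (fun _ y => suc (suc y)) := ⟨inferInstance⟩

instance : Fn1 (M := M) dbl := ⟨by unfold dbl; infer_instance⟩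

theorem dbl_emp : dbl (emp : M) = emp := recM_zero

theorem dbl_suc {n : M} (hn : n ∈ₘ om) : dbl (suc n) = suc (suc (dbl n)) := recM_suc hn

theorem dbl_mem_om {n : M} (hn : n ∈ₘ om) : dbl n ∈ₘ om := by
  refine om_induction (fun n => dbl n ∈ₘ om) (by simp [dbl_emp]) (fun n hn ih => ?_) hn
  rw [dbl_suc hn]; exact suc_mem_om (suc_mem_om ih)

theorem dbl_inj {m n : M} (hm : m ∈ₘ om) (hn : n ∈ₘ om) (h : dbl m = dbl n) : m = n := by
  refine om_induction (fun m => ∀ n, n ∈ₘ om → dbl m = dbl n → m = n)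
    (fun n hn h => ?_) (fun m hm ih n hn h => ?_) hm n hn h
  · rcases om_cases hn with rfl | ⟨k, hk, rfl⟩
    · rfl
    · rw [dbl_emp, dbl_suc hk] at h
      exact (suc_ne_emp _ h.symm).elim
  · rcases om_cases hn with rfl | ⟨k, hk, rfl⟩
    · rw [dbl_emp, dbl_suc hm] at h
      exact (suc_ne_emp _ h).elim
    · rw [dbl_suc hk, dbl_suc hm] at h
      rw [ih k hk (suc_inj (suc_inj h))]

theorem mem_dbl {n : M} (hn : n ∈ₘ om) (h0 : n ≠ emp) : n ∈ₘ dbl n := by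
  refine om_induction (fun n => n = emp ∨ n ∈ₘ dbl n) (Or.inl rfl) (fun n hn ih => ?_) hn
    |>.resolve_left h0
  rw [dbl_suc hn]
  rcases ih with rfl | ih
  · rw [dbl_emp]; exact Or.inr (by simp)
  · exact Or.inr (mem_suc.2 (Or.inl (suc_mem_suc (dbl_mem_om hn) ih)))

/-- Induction on `n`, removing one point from each of the two sets: this matches the recursion `2(n
+ 1) = 2n + 2`. -/
theorem cup_mem_crd {X x y n : M} (hn : n ∈ₘ om) (hx : x ∈ₘ crd X n) (hy : y ∈ₘ crd X n)
    (hd : ∀ z, z ∈ₘ x → ¬ z ∈ₘ y) : cup x y ∈ₘ crd X (dbl n) := by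
  refine om_induction (fun n => ∀ x y, x ∈ₘ crd X n → y ∈ₘ crd X n → (∀ z, z ∈ₘ x → ¬ z ∈ₘ y) →
    cup x y ∈ₘ crd X (dbl n)) (fun x y hx hy _ => ?_) (fun n hn ih x y hx hy hd => ?_) hn x y hx hy hd
  · rw [mem_crd_emp] at hx hy
    rw [dbl_emp, mem_crd_emp, hx, hy, cup_emp]
  · obtain ⟨hxX, ⟨a, ha⟩, hxd⟩ := (mem_crd_suc hn).1 hx
    obtain ⟨hyX, ⟨b, hb⟩, hyd⟩ := (mem_crd_suc hn).1 hy
    have h1 := ih _ _ (hxd a ha) (hyd b hb)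
      (fun z hz hz' => hd z (mem_del.1 hz).1 (mem_del.1 hz').1)
    have hab : b ≠ a := by rintro rfl; exact hd b ha hb
    have h2 := ins_mem_crd (dbl_mem_om hn) h1 (hxX a ha)
      (by simp only [mem_cup, mem_del]; have := hd a ha; tauto)
    have h3 := ins_mem_crd (suc_mem_om (dbl_mem_om hn)) h2 (hyX b hb)
      (by simp only [mem_ins, mem_cup, mem_del]; have := fun h => hd b h hb; tauto)
    rw [dbl_suc hn]
    rwa [show ins (ins (cup (del x a) (del y b)) a) b = cup x y from ext fun z => by
      simp only [mem_ins, mem_cup, mem_del]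
      by_cases h1 : z = a
      · subst h1; simp [ha]
      · by_cases h2 : z = b
        · subst h2; simp [hb]
        · simp [h1, h2] ] at h3

/-! ### A set of numbers that separates every `k ≠ 0` from `2 k` -/

/-- The elements below `n` of the set `altSet`. -/
noncomputable def altStage (n : M) : M :=
  recM emp (fun n A => sep (suc n) fun m =>
    m ∈ₘ A ∨ (m = n ∧ ∃ k, k ∈ₘ n ∧ n = dbl k ∧ ¬ k ∈ₘ A)) n

instance altStage_step : Fn2 (M := M) (fun n A => sep (suc n) fun m =>
    m ∈ₘ A ∨ (m = n ∧ ∃ k, k ∈ₘ n ∧ n = dbl k ∧ ¬ k ∈ₘ A)) := ⟨inferInstance⟩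

instance : Fn1 (M := M) altStage := ⟨by unfold altStage; infer_instance⟩

theorem altStage_emp : altStage (emp : M) = emp := recM_zero

theorem mem_altStage_suc {m n : M} (hn : n ∈ₘ om) : m ∈ₘ altStage (suc n) ↔ m ∈ₘ suc n ∧
    (m ∈ₘ altStage n ∨ (m = n ∧ ∃ k, k ∈ₘ n ∧ n = dbl k ∧ ¬ k ∈ₘ altStage n)) := by
  rw [altStage, recM_suc hn, mem_sep]; rfl

/-- Coherence of the stages: membership of `m` is settled at stage `m + 1` and never changes later.
-/
theorem mem_altStage {m n : M} (hn : n ∈ₘ om) :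
    m ∈ₘ altStage n ↔ m ∈ₘ n ∧ m ∈ₘ altStage (suc m) := by
  refine om_induction (fun n => ∀ m, m ∈ₘ altStage n ↔ m ∈ₘ n ∧ m ∈ₘ altStage (suc m))
    (fun m => by simp [altStage_emp]) (fun n hn ih m => ?_) hn m
  by_cases e : m = n
  · subst e; simp
  · rw [mem_altStage_suc hn, ih m, mem_suc]
    tauto

/-- The numbers `2 ^ e * q` with `q` and `e` odd. -/
noncomputable def altSet : M := sep om fun n => n ∈ₘ altStage (suc n)

/-- For `k ≠ 0` one has `k < 2k`, so `k` is already decided when `2k` is admitted, and by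
construction `2k` is admitted exactly if `k` was not. At `k = 0` this would be contradictory. -/
theorem dbl_mem_altSet {k : M} (hk : k ∈ₘ om) (h0 : k ≠ emp) :
    dbl k ∈ₘ altSet ↔ ¬ k ∈ₘ altSet := by
  have h2 := dbl_mem_om hk
  have hlt := mem_dbl hk h0
  have hno : ¬ dbl k ∈ₘ altStage (dbl k) := fun h =>
    notMem_self _ ((mem_altStage h2).1 h).1
  have hk' : k ∈ₘ altStage (dbl k) ↔ k ∈ₘ altSet := by
    rw [mem_altStage h2, altSet, mem_sep]
    simp [hlt, hk]
  rw [altSet, mem_sep, mem_altStage_suc h2, ← altSet, ← hk']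
  constructor
  · rintro ⟨-, -, h | ⟨-, j, hj, e, h⟩⟩
    · exact (hno h).elim
    · rwa [dbl_inj hk (om_trans hj h2) e, ← e]
  · exact fun h => ⟨h2, by simp, Or.inr ⟨rfl, k, hlt, rfl, h⟩⟩

/-- A transitive relation between consecutive terms of a sequence spreads to all earlier and later
terms; it serves for sizes, inclusions and the order of blocks. -/
theorem rel_of_mem {f : M → M} [Fn1 f] {R : M → M → Prop} [Def2 R]
    (hs : ∀ n, n ∈ₘ om → R (f n) (f (suc n)))
    (ht : ∀ l m n, l ∈ₘ om → m ∈ₘ om → n ∈ₘ om → R (f l) (f m) → R (f m) (f n) → R (f l) (f n))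
    {m n : M} (hn : n ∈ₘ om) (hmn : m ∈ₘ n) : R (f m) (f n) := by
  refine om_induction (fun n => ∀ m, m ∈ₘ n → R (f m) (f n)) (by simp) (fun n hn ih m hm => ?_) hn
    m hmn
  rcases mem_suc.1 hm with hm | rfl
  · exact ht m n (suc n) (om_trans hm hn) hn (suc_mem_om hn) (ih m hm) (hs n hn)
  · exact hs m hn

theorem isTwo_iff {t : M} : IsTwo t ↔ t = suc (suc emp) := by
  simp [IsTwo, isEmptySet_iff, isSucc_iff]

theorem eq_emp_or_eq_suc_emp {x : M} (h : Subset x (suc emp)) : x = emp ∨ x = suc emp := by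
  by_cases he : emp ∈ₘ x
  · refine Or.inr (Subset.antisymm h fun z hz => ?_)
    rcases mem_suc.1 hz with hz | rfl
    · exact (notMem_emp z hz).elim
    · exact he
  · refine Or.inl (eq_emp fun z hz => ?_)
    rcases mem_suc.1 (h z hz) with hz' | rfl
    · exact notMem_emp z hz'
    · exact he hz

/-! ### Hindman's theorem makes `[X]^{<ω}` Dedekind-infinite -/

/-- Injectivity of the cardinality makes the cardinalities in `Y` unbounded, and it makes the member
of next larger cardinality unique. Iterating this successor requires no choice. -/
theorem isDedekindInfinite_of_card_inj {X Y : M} (hY : Subset Y (fpow X)) (hinf : ¬ IsFinite Y)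
    (hc : ∀ y y', y ∈ₘ Y → y' ∈ₘ Y → card X y = card X y' → y = y') :
    IsDedekindInfinite (fpow X) := by
  have hom : ∀ y, y ∈ₘ Y → card X y ∈ₘ om := fun y hy => (card_spec (hY y hy)).1
  have hunb : ∀ n, n ∈ₘ om → ∃ y, y ∈ₘ Y ∧ n ∈ₘ card X y := by
    intro n hn
    by_contra! hno
    refine hinf (isFinite_of_inj (isFinite_of_mem_om (suc_mem_om hn)) (card X) (fun y hy => ?_) hc)
    rcases trichotomy (hom y hy) hn with h | h | h
    · exact mem_suc.2 (Or.inl h)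
    · exact mem_suc.2 (Or.inr h)
    · exact (hno y hy h).elim
  let nxt : M → M := fun y => theM fun y' => y' ∈ₘ Y ∧ card X y ∈ₘ card X y' ∧
    ∀ y'', y'' ∈ₘ Y → card X y ∈ₘ card X y'' → ¬ card X y'' ∈ₘ card X y'
  have hnxt : ∀ y, y ∈ₘ Y → nxt y ∈ₘ Y ∧ card X y ∈ₘ card X (nxt y) := by
    intro y hy
    obtain ⟨z, hz, hyz⟩ := hunb _ (hom y hy)
    obtain ⟨m, hm, ⟨y', hy', rfl, hlt⟩, hmin⟩ := exists_minimal
      (P := fun m => ∃ y', y' ∈ₘ Y ∧ m = card X y' ∧ card X y ∈ₘ m) (hom z hz) ⟨z, hz, rfl, hyz⟩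
    have hmin' : ∀ y'', y'' ∈ₘ Y → card X y ∈ₘ card X y'' → ¬ card X y'' ∈ₘ card X y' :=
      fun y'' h'' hlt'' hc => hmin _ hc (hom _ h'') ⟨y'', h'', rfl, hlt''⟩
    have : nxt y = y' := theM_eq ⟨hy', hlt, hmin'⟩ fun w ⟨hw, hw1, hw2⟩ => by
      refine hc _ _ hw hy' ?_
      rcases trichotomy (hom w hw) (hom y' hy') with h | h | h
      · exact (hmin' w hw hw1 h).elim
      · exact h
      · exact (hw2 y' hy' hlt h).elim
    rw [this]
    exact ⟨hy', hlt⟩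
  have : Fn2 fun _ y : M => nxt y := ⟨inferInstance⟩
  obtain ⟨y0, hy0, -⟩ := hunb emp emp_mem_om
  let s : M → M := recM y0 fun _ y => nxt y
  have hs0 : s emp = y0 := recM_zero
  have hss : ∀ n, n ∈ₘ om → s (suc n) = nxt (s n) := fun n hn => recM_suc hn
  have hsF : Fn1 s := inferInstanceAs (Fn1 (recM y0 fun _ y => nxt y))
  have hsY : ∀ n, n ∈ₘ om → s n ∈ₘ Y := fun n hn =>
    om_induction (fun n => s n ∈ₘ Y) (by rwa [hs0])
      (fun n hn ih => by rw [hss n hn]; exact (hnxt _ ih).1) hn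
  have hR : Def2 fun y y' : M => card X y ∈ₘ card X y' := ⟨inferInstance⟩
  have hlt : ∀ m n, m ∈ₘ n → n ∈ₘ om → card X (s m) ∈ₘ card X (s n) := fun m n hmn hn =>
    rel_of_mem (f := s) (R := fun y y' => card X y ∈ₘ card X y')
      (fun n hn => by rw [hss n hn]; exact (hnxt _ (hsY n hn)).2)
      (fun l m n _ _ hn h h' => mem_trans h h' (hom _ (hsY n hn))) hn hmn
  refine isDedekindInfinite_iff.2 ⟨gr om s, isInj_gr (fun n hn => hY _ (hsY n hn)) ?_⟩
  intro m n hm hn e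
  rcases trichotomy hm hn with h | h | h
  · exact (notMem_self _ (e ▸ hlt m n h hn)).elim
  · exact h
  · exact (notMem_self _ (e ▸ hlt n m h hm)).elim

theorem HT.finPowersets (h : HT M) : FinPowersetsDedekindInfinite M := by
  intro X hX
  refine ⟨fpow X, isFinPowerset_iff.2 rfl, ?_⟩
  -- The colour is a truth value coded as a subset of `1 = {∅}`, which is `0` or `1`.
  let F : M → M := fun x => sep (suc emp) fun _ => card X x ∈ₘ altSet
  have hF : ∀ x, x ∈ₘ fpow X → F x ∈ₘ suc (suc emp) := fun x _ => by
    rcases eq_emp_or_eq_suc_emp (x := F x) (fun z hz => (mem_sep.1 hz).1) with e | e <;>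
      simp [e]
  have hemp : ∀ x, emp ∈ₘ F x ↔ card X x ∈ₘ altSet := fun x => by simp [F]
  obtain ⟨Y, hYP, hYinf, hYd, U, hU, i, hi⟩ := h X hX (fpow X) (suc (suc emp))
    (gr (fpow X) F) (isFinPowerset_iff.2 rfl) (isTwo_iff.2 rfl) (isFun_gr hF)
  refine isDedekindInfinite_of_card_inj hYP hYinf fun y y' hy hy' hc => ?_
  by_contra hne
  have hsing : IsFinite (ins emp y) := isFinite_emp.ins y
  -- `y` and `y ∪ y'` lie in `FU(Y)` as the unions of `{y}` and `{y, y'}`.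
  have h1 : y ∈ₘ U := (hU y).2 ⟨ins emp y, fun z hz => by
    rw [show z = y by simpa using hz]; exact hy, hsing,
    fun he => he y (by simp), isUnion_iff.2 (by rw [sUn_ins, sUn_emp]; exact ext (by simp))⟩
  have h2 : cup y y' ∈ₘ U := (hU _).2 ⟨ins (ins emp y) y', fun z hz => by
      rcases mem_ins.1 hz with hz | rfl
      · rw [show z = y by simpa using hz]; exact hy
      · exact hy', hsing.ins y',
    fun he => he y (by simp), isUnion_iff.2 (by rw [sUn_ins, sUn_ins, sUn_emp]; exact ext (by simp))⟩
  have e1 := (app_gr.1 (hi _ h1)).2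
  have e2 := (app_gr.1 (hi _ h2)).2
  obtain ⟨hk, hyk⟩ := card_spec (hYP y hy)
  obtain ⟨-, hyk'⟩ := card_spec (hYP y' hy')
  rw [← hc] at hyk'
  have h0 : card X y ≠ emp := fun h0 => by
    rw [h0, mem_crd_emp] at hyk hyk'
    exact hne (hyk.trans hyk'.symm)
  have hcup := card_eq (dbl_mem_om hk) (cup_mem_crd hk hyk hyk'
    (fun z hz hz' => hYd y y' hy hy' hne ⟨z, hz, hz'⟩))
  have := dbl_mem_altSet hk h0
  rw [← hcup, ← hemp, ← hemp, ← e1, ← e2] at this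
  tauto

end Card

/-! ### Hindman's theorem on `ω` without choice -/

section Hindman

set_option linter.unusedSectionVars false
set_option synthInstance.maxHeartbeats 400000
set_option synthInstance.maxSize 100000

variable {M : Type u} [setLang.Structure M] [hZF : ZF M]

/-! ### A definable choice of a finite set of natural numbers -/

/-- The largest element of the symmetric difference of `s` and `t` lies in `t`. -/
def ColexLT (s t : M) : Prop := ∃ k, k ∈ₘ t ∧ ¬ k ∈ₘ s ∧ ∀ j, k ∈ₘ j → (j ∈ₘ s ↔ j ∈ₘ t)

instance : Def2 (M := M) ColexLT := ⟨by unfold ColexLT; infer_instance⟩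

theorem ColexLT.asymm {s t : M} (hs : Subset s om) (ht : Subset t om) (h : ColexLT s t)
    (h' : ColexLT t s) : False := by
  obtain ⟨k, hkt, hks, hk⟩ := h
  obtain ⟨l, hls, hlt, hl⟩ := h'
  rcases trichotomy (ht k hkt) (hs l hls) with h | rfl | h
  · exact hlt ((hk l h).1 hls)
  · exact hlt hkt
  · exact hks ((hl k h).1 hkt)

/-- Induction on the bound. Sets omitting the top element `n` precede those containing it, so if
there are any, only they compete; otherwise `n` lies in every set and can be deleted from all of
them. -/
theorem exists_colex_least {n A a : M} (hn : n ∈ₘ om) (hA : ∀ s, s ∈ₘ A → Subset s n)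
    (ha : a ∈ₘ A) : ∃ s, s ∈ₘ A ∧ ∀ t, t ∈ₘ A → t = s ∨ ColexLT s t := by
  refine om_induction (fun n => ∀ A a, (∀ s, s ∈ₘ A → Subset s n) → a ∈ₘ A →
    ∃ s, s ∈ₘ A ∧ ∀ t, t ∈ₘ A → t = s ∨ ColexLT s t) (fun A a hA ha => ?_)
    (fun n hn ih A a hA ha => ?_) hn A a hA ha
  · have : ∀ s, s ∈ₘ A → s = emp := fun s hs => eq_emp fun z hz => notMem_emp z (hA s hs z hz)
    exact ⟨a, ha, fun t ht => Or.inl ((this t ht).trans (this a ha).symm)⟩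
  · have hdel : ∀ s, s ∈ₘ A → ∀ z, z ∈ₘ s → z ≠ n → z ∈ₘ n := fun s hs z hz hne =>
      (mem_suc.1 (hA s hs z hz)).resolve_right hne
    have hout : ∀ s j, s ∈ₘ A → n ∈ₘ j → ¬ j ∈ₘ s := fun s j hs hj hjs => by
      rcases mem_suc.1 (hA s hs j hjs) with h | rfl
      · exact notMem_of_mem h hj
      · exact notMem_self _ hj
    by_cases hex : ∃ b, b ∈ₘ A ∧ ¬ n ∈ₘ b
    · obtain ⟨b, hb, hnb⟩ := hex
      obtain ⟨s, hs, hmin⟩ := ih (sep A fun t => ¬ n ∈ₘ t) b (fun s hs z hz => by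
        rw [mem_sep] at hs
        exact hdel s hs.1 z hz (by rintro rfl; exact hs.2 hz)) (mem_sep.2 ⟨hb, hnb⟩)
      rw [mem_sep] at hs
      refine ⟨s, hs.1, fun t ht => ?_⟩
      by_cases hnt : n ∈ₘ t
      · exact Or.inr ⟨n, hnt, hs.2, fun j hj =>
          ⟨fun h => (hout s j hs.1 hj h).elim, fun h => (hout t j ht hj h).elim⟩⟩
      · exact hmin t (mem_sep.2 ⟨ht, hnt⟩)
    · push Not at hex
      obtain ⟨s', hs', hmin⟩ := ih (img A fun t => del t n) (del a n) (fun s hs z hz => by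
        obtain ⟨t, ht, rfl⟩ := mem_img.1 hs
        rw [mem_del] at hz
        exact hdel t ht z hz.1 hz.2) (mem_img.2 ⟨a, ha, rfl⟩)
      obtain ⟨s, hs, rfl⟩ := mem_img.1 hs'
      refine ⟨s, hs, fun t ht => ?_⟩
      rcases hmin (del t n) (mem_img.2 ⟨t, ht, rfl⟩) with h | ⟨k, hkt, hks, hk⟩
      · left; rw [← ins_del (hex t ht), h, ins_del (hex s hs)]
      · rw [mem_del] at hkt hks
        refine Or.inr ⟨k, hkt.1, fun h => hks ⟨h, hkt.2⟩, fun j hj => ?_⟩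
        by_cases hjn : j = n
        · subst hjn; exact iff_of_true (hex s hs) (hex t ht)
        · simpa [hjn] using hk j hj

/-- `s` is the chosen element of `A`. -/
def IsChoice (A s : M) : Prop := ∃ n, n ∈ₘ om ∧ (∀ k, k ∈ₘ n → ¬ ∃ a, a ∈ₘ A ∧ Subset a k) ∧
  s ∈ₘ A ∧ Subset s n ∧ ∀ t, t ∈ₘ A → Subset t n → t = s ∨ ColexLT s t

instance : Def2 (M := M) IsChoice := ⟨by unfold IsChoice; infer_instance⟩

/-- An element of the set `A` of finite subsets of `ω`. -/
noncomputable def ch (A : M) : M := theM fun s => IsChoice A s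

instance : Fn1 (M := M) ch := ⟨by unfold ch; infer_instance⟩

/-- The least `n` that includes some member of `A` cuts the candidates down to subsets of `n`, among
which the colex-least one is unique. -/
theorem ch_mem {A a : M} (hA : Subset A (fpow om)) (ha : a ∈ₘ A) : ch A ∈ₘ A := by
  have hA' : ∀ a, a ∈ₘ A → Subset a om := fun a ha => (mem_fpow.1 (hA a ha)).1
  obtain ⟨n₀, hn₀, hb⟩ := (mem_fpow.1 (hA a ha)).2.bounded (hA' a ha)
  obtain ⟨n, hn, ⟨b, hbA, hbn⟩, hmin⟩ := exists_minimal (P := fun n => ∃ a, a ∈ₘ A ∧ Subset a n)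
    hn₀ ⟨a, ha, hb⟩
  obtain ⟨s, hs, hleast⟩ := exists_colex_least (A := sep A fun a => Subset a n) (a := b) hn
    (fun s hs => (mem_sep.1 hs).2) (mem_sep.2 ⟨hbA, hbn⟩)
  rw [mem_sep] at hs
  have h : ∃! s, IsChoice A s := by
    refine ⟨s, ⟨n, hn, fun k hk => hmin k hk (om_trans hk hn), hs.1, hs.2, fun t ht htn =>
      hleast t (mem_sep.2 ⟨ht, htn⟩)⟩, ?_⟩
    rintro t ⟨m, hm, hmmin, ht, htm, htleast⟩
    obtain rfl : m = n := by
      rcases trichotomy hm hn with h | h | h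
      · exact (hmin m h hm ⟨t, ht, htm⟩).elim
      · exact h
      · exact (hmmin n h ⟨s, hs⟩).elim
    rcases hleast t (mem_sep.2 ⟨ht, htm⟩) with h | h
    · exact h
    · rcases htleast s hs.1 hs.2 with h' | h'
      · exact h'.symm
      · exact (h.asymm (hA' s hs.1) (hA' t ht) h').elim
  obtain ⟨_, _, _, h, _⟩ := theM_spec h
  exact h

/-! ### Hindman's theorem for finite sets of natural numbers -/

/-- `s ∩ t = ∅` -/
def Disj (s t : M) : Prop := ∀ z, z ∈ₘ s → ¬ z ∈ₘ t

instance : Def2 (M := M) Disj := ⟨by unfold Disj; infer_instance⟩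

theorem Disj.symm {s t : M} (h : Disj s t) : Disj t s := fun z hz hz' => h z hz' hz

theorem disj_cup_right {s t r : M} : Disj s (cup t r) ↔ Disj s t ∧ Disj s r := by
  simp only [Disj, mem_cup, not_or]
  exact ⟨fun h => ⟨fun z hz => (h z hz).1, fun z hz => (h z hz).2⟩,
    fun h z hz => ⟨h.1 z hz, h.2 z hz⟩⟩

theorem disj_cup_left {s t r : M} : Disj (cup t r) s ↔ Disj t s ∧ Disj r s := by
  simp only [Disj, mem_cup]
  exact ⟨fun h => ⟨fun z hz => h z (Or.inl hz), fun z hz => h z (Or.inr hz)⟩,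
    fun h z hz => hz.elim (h.1 z) (h.2 z)⟩

theorem emp_cup {x : M} : cup emp x = x := ext fun z => by simp

theorem cup_comm {x y : M} : cup x y = cup y x := ext fun z => by simp [or_comm]

theorem cup_assoc {x y z : M} : cup (cup x y) z = cup x (cup y z) := ext fun w => by
  simp [or_assoc]

/-- `S` is a set of nonempty finite subsets of `ω` that is closed under disjoint unions and
contains sets that are arbitrarily far out. -/
def IsIP (S : M) : Prop := (∀ s, s ∈ₘ S → s ∈ₘ fpow om ∧ s ≠ emp) ∧
  (∀ s t, s ∈ₘ S → t ∈ₘ S → Disj s t → cup s t ∈ₘ S) ∧ ∀ n, n ∈ₘ om → ∃ s, s ∈ₘ S ∧ Disj s n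

instance : Def1 (M := M) IsIP := ⟨by unfold IsIP; simp only [ne_eq]; infer_instance⟩

/-- `X` meets every `IsIP` subset of `S`. -/
def Large (X S : M) : Prop := ∀ S', IsIP S' → Subset S' S → ∃ x, x ∈ₘ S' ∧ x ∈ₘ X

instance : Def2 (M := M) Large := ⟨by unfold Large; infer_instance⟩

theorem Large.mono {X Y S S' : M} (h : Large X S) (hXY : Subset X Y) (hS : Subset S' S) :
    Large Y S' := fun R hR hRS =>
  let ⟨x, hx, hxX⟩ := h R hR (hRS.trans hS)
  ⟨x, hx, hXY x hxX⟩

/-- The elements of `S` that are disjoint from `n` and from all elements of `T`. -/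
noncomputable def tail (S n T : M) : M := sep S fun d => Disj d n ∧ ∀ u, u ∈ₘ T → Disj u d

theorem mem_tail {S n T d : M} :
    d ∈ₘ tail S n T ↔ d ∈ₘ S ∧ Disj d n ∧ ∀ u, u ∈ₘ T → Disj u d := mem_sep

theorem tail_subset {S n T : M} : Subset (tail S n T) S := fun _ h => (mem_tail.1 h).1

theorem subset_om_of_mem_om {n : M} (hn : n ∈ₘ om) : Subset n om := fun _ h => om_trans h hn

theorem IsIP.exists_mem_tail {S n T : M} (hS : IsIP S) (hn : n ∈ₘ om) (hT : IsFinite T)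
    (hT' : ∀ u, u ∈ₘ T → u ∈ₘ fpow om) : ∃ d, d ∈ₘ tail S n T := by
  have hfin : IsFinite (cup n (sUn T)) :=
    (isFinite_of_mem_om hn).cup (hT.sUn fun u hu => (mem_fpow.1 (hT' u hu)).2)
  obtain ⟨l, hl, hsub⟩ := hfin.bounded fun z hz => by
    rcases mem_cup.1 hz with hz | hz
    · exact om_trans hz hn
    · obtain ⟨u, hu, hz⟩ := mem_sUn.1 hz
      exact (mem_fpow.1 (hT' u hu)).1 z hz
  obtain ⟨d, hd, hdl⟩ := hS.2.2 l hl
  exact ⟨d, mem_tail.2 ⟨hd, fun z hz hzn => hdl z hz (hsub z (mem_cup.2 (Or.inl hzn))),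
    fun u hu z hzu hz => hdl z hz (hsub z (mem_cup.2 (Or.inr (mem_sUn.2 ⟨u, hu, hzu⟩))))⟩⟩

theorem IsIP.tail {S n T : M} (hS : IsIP S) (hn : n ∈ₘ om) (hT : IsFinite T)
    (hT' : ∀ u, u ∈ₘ T → u ∈ₘ fpow om) : IsIP (tail S n T) := by
  refine ⟨fun s hs => hS.1 s (tail_subset s hs), fun s t hs ht hd => ?_, fun k hk => ?_⟩
  · rw [mem_tail] at hs ht ⊢
    exact ⟨hS.2.1 s t hs.1 ht.1 hd, disj_cup_left.2 ⟨hs.2.1, ht.2.1⟩,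
      fun u hu => disj_cup_right.2 ⟨hs.2.2 u hu, ht.2.2 u hu⟩⟩
  -- Adding the number `n`, itself a finite subset of `ω`, to `T` makes `d` avoid both bounds `k`
  -- and `n`.
  · obtain ⟨d, hd⟩ := hS.exists_mem_tail (T := ins T n) hk (hT.ins n) fun u hu => by
      rcases mem_ins.1 hu with hu | rfl
      · exact hT' u hu
      · exact mem_fpow.2 ⟨subset_om_of_mem_om hn, isFinite_of_mem_om hn⟩
    rw [mem_tail] at hd
    exact ⟨d, mem_tail.2 ⟨hd.1, (hd.2.2 n (by simp)).symm,
      fun u hu => hd.2.2 u (mem_ins.2 (Or.inl hu))⟩, hd.2.1⟩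

/-- `T ∪ {u ∪ d | u ∈ T}` -/
noncomputable def adj (T d : M) : M := cup T (img T fun u => cup u d)

instance : Fn2 (M := M) adj := ⟨by unfold adj; infer_instance⟩

theorem mem_adj {T d x : M} : x ∈ₘ adj T d ↔ x ∈ₘ T ∨ ∃ u, u ∈ₘ T ∧ x = cup u d := by
  rw [adj, mem_cup, mem_img]

/-- `T` is a finite set, closed under disjoint unions, of `∅` and elements of `S`. -/
def IsApprox (S T : M) : Prop := emp ∈ₘ T ∧ IsFinite T ∧ (∀ u, u ∈ₘ T → u = emp ∨ u ∈ₘ S) ∧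
  ∀ u v, u ∈ₘ T → v ∈ₘ T → Disj u v → cup u v ∈ₘ T

instance : Def2 (M := M) IsApprox := ⟨by unfold IsApprox; infer_instance⟩

theorem IsApprox.mem_fpow {S T u : M} (hS : IsIP S) (hT : IsApprox S T) (hu : u ∈ₘ T) :
    u ∈ₘ fpow om := by
  rcases hT.2.2.1 u hu with rfl | h
  · exact ZFModel.mem_fpow.2 ⟨fun z hz => (notMem_emp z hz).elim, isFinite_emp⟩
  · exact (hS.1 u h).1

theorem IsApprox.cup_mem {S T u d : M} (hS : IsIP S) (hT : IsApprox S T) (hu : u ∈ₘ T)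
    (hd : d ∈ₘ S) (hud : Disj u d) : cup u d ∈ₘ S := by
  rcases hT.2.2.1 u hu with rfl | h
  · rwa [emp_cup]
  · exact hS.2.1 u d h hd hud

theorem IsApprox.adj {S T d : M} (hS : IsIP S) (hT : IsApprox S T) (hd : d ∈ₘ S)
    (hdT : ∀ u, u ∈ₘ T → Disj u d) : IsApprox S (adj T d) := by
  refine ⟨mem_adj.2 (Or.inl hT.1), hT.2.1.cup hT.2.1.img, fun u hu => ?_, fun u v hu hv huv => ?_⟩
  · rcases mem_adj.1 hu with hu | ⟨u, hu', rfl⟩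
    · exact hT.2.2.1 u hu
    · exact Or.inr (hT.cup_mem hS hu' hd (hdT u hu'))
  · rcases mem_adj.1 hu with hu | ⟨u, hu', rfl⟩ <;> rcases mem_adj.1 hv with hv | ⟨v, hv', rfl⟩
    · exact mem_adj.2 (Or.inl (hT.2.2.2 u v hu hv huv))
    · exact mem_adj.2 (Or.inr ⟨cup u v, hT.2.2.2 u v hu hv' (disj_cup_right.1 huv).1,
        cup_assoc.symm⟩)
    · refine mem_adj.2 (Or.inr ⟨cup u v, hT.2.2.2 u v hu' hv (disj_cup_left.1 huv).1, ?_⟩)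
      rw [cup_assoc, cup_assoc, cup_comm (x := d)]
    -- Both sets contain the nonempty `d`, so they are not disjoint.
    · obtain ⟨z, hz⟩ := exists_mem (hS.1 d hd).2
      exact (huv z (mem_cup.2 (Or.inr hz)) (mem_cup.2 (Or.inr hz))).elim

theorem isApprox_singleton_emp {S : M} : IsApprox S (upair emp emp) := by
  refine ⟨by simp, ?_, by simp, fun u v hu hv _ => ?_⟩
  · have := (isFinite_emp (M := M)).ins emp
    rwa [show ins (emp : M) emp = upair emp emp from ext fun z => by simp] at this
  · simp only [mem_upair, or_self] at hu hv ⊢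
    rw [hu, hv, cup_emp]

/-- The recursion scheme behind every construction below: if approximations with property `Q` can be
extended arbitrarily far out, `ch` selects the extensions, and the union of the resulting chain,
without `∅`, is an IP set. -/
theorem IsIP.exists_of_extend {S : M} (hS : IsIP S) (Q : M → Prop) [hQ : DfnP M Q]
    (h0 : Q (upair emp emp))
    (hs : ∀ n T, n ∈ₘ om → IsApprox S T → Q T → ∃ d, d ∈ₘ ZFModel.tail S n T ∧ Q (ZFModel.adj T d)) :
    ∃ S', IsIP S' ∧ Subset S' S ∧ ∀ u, u ∈ₘ S' → ∃ T, Q T ∧ u ∈ₘ T := by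
  have : Def1 Q := ⟨hQ⟩
  let D : M → M → M := fun n T => sep S fun d =>
    (Disj d n ∧ ∀ u, u ∈ₘ T → Disj u d) ∧ Q (ZFModel.adj T d)
  have hD : ∀ n T, n ∈ₘ om → IsApprox S T → Q T →
      ch (D n T) ∈ₘ ZFModel.tail S n T ∧ Q (ZFModel.adj T (ch (D n T))) := fun n T hn hT hQT => by
    obtain ⟨d, hd, hdQ⟩ := hs n T hn hT hQT
    rw [mem_tail] at hd
    have : ch (D n T) ∈ₘ D n T := ch_mem (a := d) (fun s h => (hS.1 s (mem_sep.1 h).1).1)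
      (mem_sep.2 ⟨hd.1, hd.2, hdQ⟩)
    have := mem_sep.1 this
    exact ⟨mem_tail.2 ⟨this.1, this.2.1⟩, this.2.2⟩
  have hG : Fn2 fun n T : M => ZFModel.adj T (ch (D n T)) := ⟨inferInstance⟩
  let f : M → M := recM (upair emp emp) fun n T => ZFModel.adj T (ch (D n T))
  have hf : Fn1 f := inferInstanceAs (Fn1 (recM _ _))
  have hfs : ∀ n, n ∈ₘ om → f (suc n) = ZFModel.adj (f n) (ch (D n (f n))) := fun n hn =>
    recM_suc hn
  have hinv : ∀ n, n ∈ₘ om → IsApprox S (f n) ∧ Q (f n) := fun n hn => by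
    refine om_induction (fun n => IsApprox S (f n) ∧ Q (f n)) ?_ (fun n hn ih => ?_) hn
    · rw [show f emp = upair emp emp from recM_zero]
      exact ⟨isApprox_singleton_emp, h0⟩
    · have := hD n (f n) hn ih.1 ih.2
      rw [mem_tail] at this
      rw [hfs n hn]
      exact ⟨ih.1.adj hS this.1.1 this.1.2.2, this.2⟩
  have hmono : ∀ m n, n ∈ₘ om → m ∈ₘ n → Subset (f m) (f n) := fun m n hn hmn =>
    rel_of_mem (R := Subset) (fun n hn => by
      rw [hfs n hn]; exact fun z hz => mem_adj.2 (Or.inl hz))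
      (fun l m n _ _ _ h h' => h.trans h') hn hmn
  refine ⟨sep S fun u => ∃ n, n ∈ₘ om ∧ u ∈ₘ f n, ⟨fun s h => hS.1 s (mem_sep.1 h).1,
    fun s t h h' hd => ?_, fun n hn => ?_⟩, fun s h => (mem_sep.1 h).1, fun u hu => ?_⟩
  · obtain ⟨h1, m, hm, hsm⟩ := mem_sep.1 h
    obtain ⟨h2, n, hn, htn⟩ := mem_sep.1 h'
    refine mem_sep.2 ⟨hS.2.1 s t h1 h2 hd, ?_⟩
    rcases trichotomy hm hn with h | rfl | h
    · exact ⟨n, hn, (hinv n hn).1.2.2.2 s t (hmono m n hn h s hsm) htn hd⟩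
    · exact ⟨m, hn, (hinv m hn).1.2.2.2 s t hsm htn hd⟩
    · exact ⟨m, hm, (hinv m hm).1.2.2.2 s t hsm (hmono n m hm h t htn) hd⟩
  · have := hD n (f n) hn (hinv n hn).1 (hinv n hn).2
    rw [mem_tail] at this
    refine ⟨ch (D n (f n)), mem_sep.2 ⟨this.1.1, suc n, suc_mem_om hn, ?_⟩, this.1.2.1⟩
    rw [hfs n hn]
    -- Since `∅` belongs to each approximation, the new set `d = ∅ ∪ d` itself is added.
    exact mem_adj.2 (Or.inr ⟨emp, (hinv n hn).1.1, emp_cup.symm⟩)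
  · obtain ⟨-, n, hn, hu⟩ := mem_sep.1 hu
    exact ⟨f n, (hinv n hn).2, hu⟩

/-- `{y ∈ X | y ∪ d ∈ X}` -/
noncomputable def shift (X d : M) : M := sep X fun y => cup y d ∈ₘ X

instance : Fn2 (M := M) shift := ⟨by unfold shift; infer_instance⟩

theorem mem_shift {X d y : M} : y ∈ₘ shift X d ↔ y ∈ₘ X ∧ cup y d ∈ₘ X := mem_sep

/-- `{y ∈ X | y ∪ u ∈ X for all u ∈ T}` -/
noncomputable def res (X T : M) : M := sep X fun y => ∀ u, u ∈ₘ T → cup y u ∈ₘ X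

instance : Fn2 (M := M) res := ⟨by unfold res; infer_instance⟩

theorem mem_res {X T y : M} : y ∈ₘ res X T ↔ y ∈ₘ X ∧ ∀ u, u ∈ₘ T → cup y u ∈ₘ X := mem_sep

theorem subset_res_singleton_emp {X : M} : Subset X (res X (upair emp emp)) := fun z hz =>
  mem_res.2 ⟨hz, fun u hu => by
    simp only [mem_upair, or_self] at hu
    rwa [hu, cup_emp]⟩

/-- Passing from `T` to `adj T d` costs one shift by `d`, so largeness of a shift carries the
recursions one step further. -/
theorem shift_res_subset {X T d : M} : Subset (shift (res X T) d) (res X (adj T d)) := by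
  intro y hy
  rw [mem_shift, mem_res, mem_res] at hy
  refine mem_res.2 ⟨hy.1.1, fun u hu => ?_⟩
  rcases mem_adj.1 hu with hu | ⟨v, hv, rfl⟩
  · exact hy.1.2 u hu
  · rw [cup_comm (x := v), ← cup_assoc]
    exact hy.2.2 v hv

/-! ### Large sets contain IP sets -/

/-- If no finite `E` worked, one could build an IP subset of `S` that misses `X`, against largeness.
-/
theorem Large.exists_finite_cover {X S : M} (hS : IsIP S) (hX : Large X S) :
    ∃ n E, n ∈ₘ om ∧ IsFinite E ∧ Subset E S ∧
      ∀ x, x ∈ₘ tail S n E → ∃ d, d ∈ₘ E ∧ cup x d ∈ₘ X := by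
  by_contra! hno
  obtain ⟨S', hS', hsub, hQ⟩ := hS.exists_of_extend (fun T => ∀ u, u ∈ₘ T → u = emp ∨ ¬ u ∈ₘ X)
    (by simp) fun n T hn hT hQ => by
      obtain ⟨a, ha⟩ := hS.exists_mem_tail hn hT.2.1 fun u hu => hT.mem_fpow hS hu
      rw [mem_tail] at ha
      -- The auxiliary `a` keeps `E = {u ∪ a | u ∈ T}` inside `S` even for `u = ∅`. An `x` not
      -- covered by `E` makes every `u ∪ (a ∪ x)` avoid `X`.
      obtain ⟨x, hx, hxE⟩ := hno n (img T fun u => cup u a) hn hT.2.1.img fun z hz => by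
        obtain ⟨u, hu, rfl⟩ := mem_img.1 hz
        exact hT.cup_mem hS hu ha.1 (ha.2.2 u hu)
      rw [mem_tail] at hx
      have hxd : ∀ u, u ∈ₘ T → Disj (cup u a) x := fun u hu => hx.2.2 _ (mem_img.2 ⟨u, hu, rfl⟩)
      refine ⟨cup a x, mem_tail.2 ⟨hS.2.1 a x ha.1 hx.1 (disj_cup_left.1 (hxd emp hT.1)).2,
        disj_cup_left.2 ⟨ha.2.1, hx.2.1⟩,
        fun u hu => disj_cup_right.2 ⟨ha.2.2 u hu, (disj_cup_left.1 (hxd u hu)).1⟩⟩, fun u hu => ?_⟩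
      rcases mem_adj.1 hu with hu | ⟨u, hu', rfl⟩
      · exact hQ u hu
      · right
        rw [← cup_assoc, cup_comm]
        exact hxE _ (mem_img.2 ⟨u, hu', rfl⟩)
  obtain ⟨x, hx, hxX⟩ := hX S' hS' hsub
  obtain ⟨T, hT, hxT⟩ := hQ x hx
  rcases hT x hxT with rfl | h
  · exact (hS'.1 _ hx).2 rfl
  · exact h hxX

/-- Induction on `E`: if the shift by `a` is not large, it misses some IP subset, on which `a` can
be dropped from the cover. -/
theorem Large.exists_shift_of_cover {X S E : M} (hE : IsFinite E) (hS : IsIP S) (hX : Large X S)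
    (h : ∀ x, x ∈ₘ S → x ∈ₘ X → ∃ d, d ∈ₘ E ∧ cup x d ∈ₘ X) :
    ∃ d S', d ∈ₘ E ∧ IsIP S' ∧ Subset S' S ∧ Large (shift X d) S' := by
  refine fin_induction (fun E => ∀ S, IsIP S → Large X S →
    (∀ x, x ∈ₘ S → x ∈ₘ X → ∃ d, d ∈ₘ E ∧ cup x d ∈ₘ X) →
    ∃ d S', d ∈ₘ E ∧ IsIP S' ∧ Subset S' S ∧ Large (shift X d) S') (fun S hS hX h => ?_)
    (fun E a _ _ ih S hS hX h => ?_) hE S hS hX h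
  · obtain ⟨x, hx, hxX⟩ := hX S hS Subset.rfl
    obtain ⟨d, hd, -⟩ := h x hx hxX
    exact (notMem_emp d hd).elim
  · by_cases hl : Large (shift X a) S
    · exact ⟨a, S, by simp, hS, Subset.rfl, hl⟩
    · simp only [Large, not_forall] at hl
      obtain ⟨S', hS', hsub, hno⟩ := hl
      obtain ⟨d, S'', hd, hS'', hsub', hl'⟩ := ih S' hS' (hX.mono Subset.rfl hsub)
        fun x hx hxX => by
          obtain ⟨d, hd, hxd⟩ := h x (hsub x hx) hxX
          rcases mem_ins.1 hd with hd | rfl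
          · exact ⟨d, hd, hxd⟩
          · exact (hno ⟨x, hx, mem_shift.2 ⟨hxX, hxd⟩⟩).elim
      exact ⟨d, S'', mem_ins.2 (Or.inl hd), hS'', hsub'.trans hsub, hl'⟩

theorem Large.exists_shift {X S n T : M} (hS : IsIP S) (hX : Large X S) (hn : n ∈ₘ om)
    (hT : IsFinite T) (hT' : ∀ u, u ∈ₘ T → u ∈ₘ fpow om) :
    ∃ d S', d ∈ₘ tail S n T ∧ IsIP S' ∧ Subset S' S ∧ Large (shift X d) S' := by
  have hS₁ := hS.tail hn hT hT'
  have hX₁ : Large X (tail S n T) := hX.mono Subset.rfl tail_subset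
  obtain ⟨m, E, hm, hE, hES, hcov⟩ := hX₁.exists_finite_cover hS₁
  -- On this second tail every element is covered by `E`.
  have hS₂ := hS₁.tail hm hE fun u hu => (hS₁.1 u (hES u hu)).1
  obtain ⟨d, S', hd, hS', hsub, hl⟩ := (hX₁.mono Subset.rfl tail_subset).exists_shift_of_cover
    hE hS₂ fun x hx _ => hcov x hx
  exact ⟨d, S', hES d hd, hS', (hsub.trans tail_subset).trans tail_subset, hl⟩

/-- `Large.exists_shift` gives no control over whether `d` lies in `X`. Iterating it yields a whole
IP set of shifts that are jointly harmless, and this IP set must meet the large set `X`. -/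
theorem Large.exists_mem_shift {X S n T : M} (hS : IsIP S) (hX : Large X S) (hn : n ∈ₘ om)
    (hT : IsFinite T) (hT' : ∀ u, u ∈ₘ T → u ∈ₘ fpow om) :
    ∃ y S', y ∈ₘ tail S n T ∧ y ∈ₘ X ∧ IsIP S' ∧ Large (shift X y) S' := by
  have hS₁ := hS.tail hn hT hT'
  have hX₁ : Large X (tail S n T) := hX.mono Subset.rfl tail_subset
  obtain ⟨S', hS', hsub, hQ⟩ := hS₁.exists_of_extend
    (fun R => ∃ S', IsIP S' ∧ Subset S' (tail S n T) ∧ Large (res X R) S')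
    ⟨_, hS₁, Subset.rfl, hX₁.mono subset_res_singleton_emp Subset.rfl⟩
    (fun k R hk hR ⟨S', hS', hsub, hl⟩ => by
      obtain ⟨d, S'', hd, hS'', hsub', hl'⟩ := hl.exists_shift hS' hk hR.2.1
        fun u hu => hR.mem_fpow hS₁ hu
      rw [mem_tail] at hd
      exact ⟨d, mem_tail.2 ⟨hsub d hd.1, hd.2⟩, S'', hS'', hsub'.trans hsub,
        hl'.mono shift_res_subset Subset.rfl⟩)
  obtain ⟨y, hy, hyX⟩ := hX₁ S' hS' hsub
  obtain ⟨R, ⟨S'', hS'', -, hl⟩, hyR⟩ := hQ y hy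
  exact ⟨y, S'', hsub y hy, hyX, hS'', hl.mono (fun z hz => by
    rw [mem_res] at hz
    exact mem_shift.2 ⟨hz.1, hz.2 y hyR⟩) Subset.rfl⟩

theorem isIP_sep_fpow {I : M} (hI : Subset I om) (hunb : ∀ n, n ∈ₘ om → ∃ k, k ∈ₘ I ∧ ¬ k ∈ₘ n) :
    IsIP (sep (fpow I) fun s => ¬ s = emp) := by
  refine ⟨fun s hs => ?_, fun s t hs ht _ => ?_, fun n hn => ?_⟩
  · rw [mem_sep, mem_fpow] at hs
    exact ⟨mem_fpow.2 ⟨hs.1.1.trans hI, hs.1.2⟩, hs.2⟩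
  · rw [mem_sep, mem_fpow] at hs ht ⊢
    obtain ⟨z, hz⟩ := exists_mem hs.2
    exact ⟨⟨fun z hz => (mem_cup.1 hz).elim (hs.1.1 z) (ht.1.1 z), hs.1.2.cup ht.1.2⟩,
      ne_emp (mem_cup.2 (Or.inl hz))⟩
  · obtain ⟨k, hk, hkn⟩ := hunb n hn
    refine ⟨ins emp k, mem_sep.2 ⟨mem_fpow.2 ⟨fun z hz => ?_, isFinite_emp.ins k⟩,
      ne_emp (mem_ins.2 (Or.inr rfl))⟩, fun z hz => ?_⟩ <;>
    · obtain rfl : z = k := by simpa using hz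
      assumption

/-- Elements of `X` are collected so that the `y` whose unions with all sets built so far stay in
`X` remain large on some IP set. The ambient family may be all nonempty finite sets, since
membership in `X` is secured directly. -/
theorem Large.exists_isIP_subset {X S : M} (hS : IsIP S) (hX : Large X S) :
    ∃ S', IsIP S' ∧ Subset S' X := by
  have hfin : IsIP (M := M) (sep (fpow om) fun s => ¬ s = emp) :=
    isIP_sep_fpow Subset.rfl fun n hn => ⟨n, hn, notMem_self n⟩
  obtain ⟨S', hS', hsub, hQ⟩ := hfin.exists_of_extend
    (fun T => (∀ u, u ∈ₘ T → u = emp ∨ u ∈ₘ X) ∧ ∃ S', IsIP S' ∧ Large (res X T) S')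
    ⟨by simp, S, hS, hX.mono subset_res_singleton_emp Subset.rfl⟩
    (fun n T hn hT ⟨hTX, S', hS', hl⟩ => by
      obtain ⟨y, S'', hy, hyX, hS'', hl'⟩ := hl.exists_mem_shift hS' hn hT.2.1
        fun u hu => hT.mem_fpow hfin hu
      rw [mem_tail] at hy
      rw [mem_res] at hyX
      refine ⟨y, mem_tail.2 ⟨mem_sep.2 (hS'.1 y hy.1), hy.2⟩, fun u hu => ?_, S'', hS'',
        hl'.mono shift_res_subset Subset.rfl⟩
      rcases mem_adj.1 hu with hu | ⟨u, hu', rfl⟩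
      · exact hTX u hu
      · right
        rw [cup_comm]
        exact hyX.2 u hu')
  refine ⟨S', hS', fun u hu => ?_⟩
  obtain ⟨T, ⟨hT, -⟩, huT⟩ := hQ u hu
  exact (hT u huT).resolve_left (hS'.1 u hu).2

/-- Each next term is chosen entirely beyond the previous one, which gives a sequence of successive
blocks. -/
theorem IsIP.exists_seq {S : M} (hS : IsIP S) : ∃ s : M → M, Fn1 s ∧ (∀ n, n ∈ₘ om → s n ∈ₘ S) ∧
    ∀ m n, m ∈ₘ n → n ∈ₘ om → ∀ i j, i ∈ₘ s m → j ∈ₘ s n → i ∈ₘ j := by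
  let nxt : M → M := fun y => ch (sep S fun t => ∀ i j, i ∈ₘ y → j ∈ₘ t → i ∈ₘ j)
  have hom : ∀ y z, y ∈ₘ S → z ∈ₘ y → z ∈ₘ om := fun y z hy hz =>
    (mem_fpow.1 (hS.1 y hy).1).1 z hz
  have hnxt : ∀ y, y ∈ₘ S → nxt y ∈ₘ S ∧ ∀ i j, i ∈ₘ y → j ∈ₘ nxt y → i ∈ₘ j := by
    intro y hy
    have hyf := mem_fpow.1 (hS.1 y hy).1
    obtain ⟨k, hk, hyk⟩ := hyf.2.bounded hyf.1
    obtain ⟨t, ht, htk⟩ := hS.2.2 k hk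
    refine mem_sep.1 (ch_mem (A := sep S fun t => ∀ i j, i ∈ₘ y → j ∈ₘ t → i ∈ₘ j) (a := t)
      (fun s h => (hS.1 s (mem_sep.1 h).1).1) (mem_sep.2 ⟨ht, fun i j hi hj => ?_⟩))
    rcases trichotomy (hyf.1 i hi) (hom t j ht hj) with h | rfl | h
    · exact h
    · exact (htk i hj (hyk i hi)).elim
    · exact (htk j hj (mem_trans h (hyk i hi) hk)).elim
  have : Fn1 nxt :=
    ⟨inferInstanceAs (DfnF fun y => ch (sep S fun t => ∀ i j, i ∈ₘ y → j ∈ₘ t → i ∈ₘ j))⟩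
  have : Fn2 fun _ y : M => nxt y := ⟨inferInstance⟩
  obtain ⟨s0, hs0, -⟩ := hS.2.2 emp emp_mem_om
  let s : M → M := recM s0 fun _ y => nxt y
  have hsF : Fn1 s := inferInstanceAs (Fn1 (recM _ _))
  have hss : ∀ n, n ∈ₘ om → s (suc n) = nxt (s n) := fun n hn => recM_suc hn
  have hsS : ∀ n, n ∈ₘ om → s n ∈ₘ S := fun n hn =>
    om_induction (fun n => s n ∈ₘ S) (by rwa [show s emp = s0 from recM_zero])
      (fun n hn ih => by rw [hss n hn]; exact (hnxt _ ih).1) hn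
  have hR : Def2 fun y t : M => ∀ i j, i ∈ₘ y → j ∈ₘ t → i ∈ₘ j := ⟨inferInstance⟩
  refine ⟨s, hsF, hsS, fun m n hmn hn => rel_of_mem
    (R := fun y t : M => ∀ i j, i ∈ₘ y → j ∈ₘ t → i ∈ₘ j) (fun n hn => ?_)
    (fun l m n _ hm hn h h' i j hi hj => ?_) hn hmn⟩
  · rw [hss n hn]; exact (hnxt _ (hsS n hn)).2
  -- Transitivity passes through an element of the middle block, which is nonempty.
  · obtain ⟨k, hk⟩ := exists_mem (hS.1 _ (hsS m hm)).2
    exact mem_trans (h i k hi hk) (h' k j hk hj) (hom _ j (hsS n hn) hj)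

end Hindman

section FromDedekindInfinite

set_option linter.unusedSectionVars false
set_option synthInstance.maxHeartbeats 400000
set_option synthInstance.maxSize 100000

variable {M : Type u} [setLang.Structure M] [hZF : ZF M]

/-! ### Hindman's theorem from an injection of `ω` into `[X]^{<ω}` -/

/-- `n` is the least number with `x ∈ f(n)`. -/
def IsFirst (f x n : M) : Prop := x ∈ₘ val f n ∧ ∀ m, m ∈ₘ n → ¬ x ∈ₘ val f m

instance : Def3 (M := M) IsFirst := ⟨by unfold IsFirst; infer_instance⟩

theorem IsFirst.unique {f x m n : M} (hm : m ∈ₘ om) (hn : n ∈ₘ om) (h : IsFirst f x m)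
    (h' : IsFirst f x n) : m = n := by
  rcases trichotomy hm hn with hmn | e | hmn
  · exact (h'.2 m hmn h.1).elim
  · exact e
  · exact (h.2 n hmn h'.1).elim

theorem exists_isFirst {f x n : M} (hn : n ∈ₘ om) (h : x ∈ₘ val f n) :
    ∃ k, k ∈ₘ om ∧ IsFirst f x k := by
  obtain ⟨k, hk, hx, hmin⟩ := exists_minimal (P := fun k => x ∈ₘ val f k) hn h
  exact ⟨k, hk, hx, fun m hm => hmin m hm (om_trans hm hk)⟩

/-- The elements of `X` that occur first in some `f(n)` with `n ∈ t`. -/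
noncomputable def blk (X f t : M) : M := sep X fun x => ∃ n, n ∈ₘ t ∧ IsFirst f x n

theorem mem_blk {X f t x : M} : x ∈ₘ blk X f t ↔ x ∈ₘ X ∧ ∃ n, n ∈ₘ t ∧ IsFirst f x n := mem_sep

instance (X f : M) : Fn1 (blk X f) := ⟨by unfold blk; infer_instance⟩

theorem blk_cup {X f s t : M} : blk X f (cup s t) = cup (blk X f s) (blk X f t) := ext fun x => by
  simp only [mem_cup, mem_blk]
  constructor
  · rintro ⟨hx, n, hn | hn, h⟩
    · exact Or.inl ⟨hx, n, hn, h⟩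
    · exact Or.inr ⟨hx, n, hn, h⟩
  · rintro (⟨hx, n, hn, h⟩ | ⟨hx, n, hn, h⟩)
    · exact ⟨hx, n, Or.inl hn, h⟩
    · exact ⟨hx, n, Or.inr hn, h⟩

theorem blk_mem_fpow {X f t : M} (hf : IsFun f om (fpow X)) (ht : t ∈ₘ fpow om) :
    blk X f t ∈ₘ fpow X := by
  rw [mem_fpow] at ht
  have hfin : IsFinite (sUn (img t (val f))) := ht.2.img.sUn fun y hy => by
    obtain ⟨n, hn, rfl⟩ := mem_img.1 hy
    exact (mem_fpow.1 (hf.val_mem (ht.1 n hn))).2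
  refine mem_fpow.2 ⟨fun x hx => (mem_blk.1 hx).1, hfin.subset fun x hx => ?_⟩
  obtain ⟨-, n, hn, h⟩ := mem_blk.1 hx
  exact mem_sUn.2 ⟨val f n, mem_img.2 ⟨n, hn, rfl⟩, h.1⟩

/-- If all first indices were below `n`, every `f(m)` would be a subset of the finite set `⋃_{k<n}
f(k)`, and `f` would inject `ω` into a finite powerset. -/
theorem exists_isFirst_unbounded {X f : M} (hf : IsInj f om (fpow X)) {n : M} (hn : n ∈ₘ om) :
    ∃ k, (k ∈ₘ om ∧ ∃ x, x ∈ₘ X ∧ IsFirst f x k) ∧ ¬ k ∈ₘ n := by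
  by_contra! hno
  have hfin : IsFinite (sUn (img n (val f))) := (isFinite_of_mem_om hn).img.sUn fun y hy => by
    obtain ⟨k, hk, rfl⟩ := mem_img.1 hy
    exact (mem_fpow.1 (hf.1.val_mem (om_trans hk hn))).2
  refine not_isFinite_om (isFinite_of_inj hfin.pow (val f) (fun m hm => ?_)
    fun k l hk hl e => hf.val_inj hk hl e)
  refine mem_pow.2 fun x hx => ?_
  obtain ⟨k, hk, hxk⟩ := exists_isFirst hm hx
  have hxX := (mem_fpow.1 (hf.1.val_mem hm)).1 x hx
  exact mem_sUn.2 ⟨val f k, mem_img.2 ⟨k, hno k ⟨hk, x, hxX, hxk⟩, rfl⟩, hxk.1⟩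

/-- Either colour `0` is large and contains an IP set, or some IP subset avoids it and so has colour
`1` throughout. -/
theorem exists_isIP_const {S c : M} (hS : IsIP S) (F : M → M) [hF : DfnF F]
    (hc : ∀ t, t ∈ₘ S → val c (F t) ∈ₘ suc (suc emp)) :
    ∃ S' i, IsIP S' ∧ Subset S' S ∧ ∀ t, t ∈ₘ S' → val c (F t) = i := by
  by_cases hl : Large (sep S fun t => val c (F t) = emp) S
  · obtain ⟨S', hS', hsub⟩ := hl.exists_isIP_subset hS
    exact ⟨S', emp, hS', fun t ht => (mem_sep.1 (hsub t ht)).1,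
      fun t ht => (mem_sep.1 (hsub t ht)).2⟩
  · simp only [Large, not_forall] at hl
    obtain ⟨S', hS', hsub, hno⟩ := hl
    refine ⟨S', suc emp, hS', hsub, fun t ht => ?_⟩
    rcases mem_suc.1 (hc t (hsub t ht)) with h | h
    · rcases mem_suc.1 h with h | h
      · exact (notMem_emp _ h).elim
      · exact (hno ⟨t, ht, mem_sep.2 ⟨hsub t ht, h⟩⟩).elim
    · exact h

theorem FinPowersetsDedekindInfinite.ht (h : FinPowersetsDedekindInfinite M) : HT M := by
  intro X hX P t c hP ht hc
  rw [isFinPowerset_iff] at hP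
  rw [isTwo_iff] at ht
  subst hP ht
  obtain ⟨P', hP', hD⟩ := h X hX
  rw [isFinPowerset_iff] at hP'
  subst hP'
  obtain ⟨f, hf⟩ := isDedekindInfinite_iff.1 hD
  let I : M := sep om fun n => ∃ x, x ∈ₘ X ∧ IsFirst f x n
  have hIom : Subset I om := fun n hn => (mem_sep.1 hn).1
  have hS₀ : IsIP (sep (fpow I) fun s => ¬ s = emp) := isIP_sep_fpow hIom fun n hn => by
    obtain ⟨k, hk, hkn⟩ := exists_isFirst_unbounded hf hn
    exact ⟨k, mem_sep.2 hk, hkn⟩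
  obtain ⟨S, i, hS, hsub, hi⟩ := exists_isIP_const (c := c) hS₀ (blk X f) fun t ht =>
    hc.val_mem (blk_mem_fpow hf.1 (hS₀.1 t ht).1)
  have hSI : ∀ t n, t ∈ₘ S → n ∈ₘ t → n ∈ₘ om ∧ ∃ x, x ∈ₘ X ∧ IsFirst f x n := fun t n ht hn =>
    mem_sep.1 ((mem_fpow.1 (mem_sep.1 (hsub t ht)).1).1 n hn)
  obtain ⟨s, hs, hsS, hsep⟩ := hS.exists_seq
  have hmem : ∀ t, t ∈ₘ S → blk X f t ∈ₘ fpow X := fun t ht => blk_mem_fpow hf.1 (hS.1 t ht).1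
  have hdisj : ∀ m n, m ∈ₘ om → n ∈ₘ om → ∀ z, z ∈ₘ blk X f (s m) → z ∈ₘ blk X f (s n) → m = n := by
    intro m n hm hn z hz hz'
    obtain ⟨-, k, hk, hzk⟩ := mem_blk.1 hz
    obtain ⟨-, l, hl, hzl⟩ := mem_blk.1 hz'
    obtain rfl := hzk.unique (hSI _ k (hsS m hm) hk).1 (hSI _ l (hsS n hn) hl).1 hzl
    rcases trichotomy hm hn with h | h | h
    · exact (notMem_self _ (hsep m n h hn k k hk hl)).elim
    · exact h
    · exact (notMem_self _ (hsep n m h hm k k hl hk)).elim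
  have hne : ∀ t, t ∈ₘ S → ∃ z, z ∈ₘ blk X f t := fun t ht => by
    obtain ⟨n, hn⟩ := exists_mem (hS.1 t ht).2
    obtain ⟨-, x, hx, hxn⟩ := hSI t n ht hn
    exact ⟨x, mem_blk.2 ⟨hx, n, hn, hxn⟩⟩
  let Y : M := img om fun n => blk X f (s n)
  have hY : ∀ y, y ∈ₘ Y ↔ ∃ n, n ∈ₘ om ∧ y = blk X f (s n) := fun y => mem_img
  have hYd : IsPairwiseDisjoint Y := by
    rintro a b ha hb hab ⟨z, hza, hzb⟩
    obtain ⟨m, hm, rfl⟩ := (hY a).1 ha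
    obtain ⟨n, hn, rfl⟩ := (hY b).1 hb
    exact hab (by rw [hdisj m n hm hn z hza hzb])
  -- Unions of nonempty finite subfamilies of `Y` are again blocks of sets in `S`, so they inherit
  -- the constant colour.
  have hFU : ∀ F, IsFinite F → Subset F Y → F = emp ∨ ∃ t, t ∈ₘ S ∧ sUn F = blk X f t := by
    intro F hF hFY
    refine fin_induction (fun F => Subset F Y → F = emp ∨ ∃ t, t ∈ₘ S ∧ sUn F = blk X f t)
      (fun _ => Or.inl rfl) (fun F a _ ha ih hFY => ?_) hF hFY
    obtain ⟨n, hn, rfl⟩ := (hY a).1 (hFY a (by simp))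
    refine Or.inr ?_
    rcases ih fun z hz => hFY z (mem_ins.2 (Or.inl hz)) with rfl | ⟨t, ht, e⟩
    · exact ⟨s n, hsS n hn, by rw [sUn_ins, sUn_emp, emp_cup]⟩
    -- `S` is closed only under disjoint unions: an index common to `t` and `s n` would give a point
    -- shared by a member of `F` and the new block, against disjointness of `Y`.
    · refine ⟨cup t (s n), hS.2.1 t _ ht (hsS n hn) fun k hkt hks => ?_, by rw [sUn_ins, e, blk_cup]⟩
      obtain ⟨-, x, hx, hxk⟩ := hSI t k ht hkt
      have hxF : x ∈ₘ sUn F := by rw [e]; exact mem_blk.2 ⟨hx, k, hkt, hxk⟩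
      obtain ⟨y, hy, hxy⟩ := mem_sUn.1 hxF
      exact hYd y _ (hFY y (mem_ins.2 (Or.inl hy))) (hFY _ (by simp))
        (fun hya => ha (by rwa [← hya])) ⟨x, hxy, mem_blk.2 ⟨hx, k, hks, hxk⟩⟩
  have hFU' : ∀ u, (∃ F, Subset F Y ∧ IsFinite F ∧ ¬ IsEmptySet F ∧ IsUnion u F) →
      ∃ t, t ∈ₘ S ∧ u = blk X f t := by
    rintro u ⟨F, hFY, hF, hF0, hu⟩
    obtain ⟨t, ht, e⟩ := (hFU F hF hFY).resolve_left fun e => hF0 (isEmptySet_iff.2 e)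
    exact ⟨t, ht, (isUnion_iff.1 hu).trans e⟩
  refine ⟨Y, fun y hy => ?_, fun hfin => ?_, hYd, sep (fpow X) fun u =>
    ∃ F, Subset F Y ∧ IsFinite F ∧ ¬ IsEmptySet F ∧ IsUnion u F, fun u => ?_, i, fun u hu => ?_⟩
  · obtain ⟨n, hn, rfl⟩ := (hY y).1 hy
    exact hmem _ (hsS n hn)
  · refine not_isFinite_om (isFinite_of_inj hfin (fun n => blk X f (s n))
      (fun n hn => (hY _).2 ⟨n, hn, rfl⟩) fun m n hm hn e => ?_)
    obtain ⟨z, hz⟩ := hne _ (hsS m hm)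
    exact hdisj m n hm hn z hz (e ▸ hz)
  · rw [mem_sep, and_iff_right_iff_imp]
    intro hu
    obtain ⟨t, ht, rfl⟩ := hFU' u hu
    exact hmem t ht
  · obtain ⟨t, ht, rfl⟩ := hFU' u (mem_sep.1 hu).2
    exact hc.app_iff.2 ⟨hmem t ht, (hi t ht).symm⟩

end FromDedekindInfinite

end ZFModel

theorem mainTheorem7 (M : Type*) [ZFModel.setLang.Structure M] (hM : ZFModel.IsModelZF M) :
    (ZFModel.HT M ↔ ZFModel.FinPowersetsDedekindInfinite M) ∧
      (ZFModel.FinEqDFin M → ZFModel.HT M) ∧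
      (ZFModel.HT M → ZFModel.Form82 M) := by
  have : ZFModel.ZF M := ⟨hM⟩
  exact ⟨⟨fun h => h.finPowersets, fun h => h.ht⟩, fun h => h.finPowersets.ht,
    fun h => h.finPowersets.form82⟩
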